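/- Let $\lambda$ be an infinite regular cardinal and $S$ a set of sorts. An $S$-sorted $\lambda$-ary signature $\Sigma$ is a set of function symbols $f\colon\sqcap_{i<\alpha}s_i\to s$ and a set of relation symbols $R\colon\sqcap_{i<\alpha}s_i$, where $\alpha<\lambda$ and $s_i,s\in S$. A context is a tuple $\mathbf{x}=(x_i\mathord{:}s_i)_{i<\alpha}$ of distinct variables with $\alpha<\lambda$. A term $\mathbf{x}.\tau$ is built from the variables of $\mathbf{x}$ by function symbols. A $\lambda$-ary Horn formula $\mathbf{x}.\phi$ is built from atomic formulas $R(\tau_i)_{i<\alpha}$ and $\tau=\tau'$ (between terms in the context $\mathbf{x}$) by conjunctions $\bigwedge_{i<\alpha}$ with $\alpha<\lambda$, where $\top$ is the empty conjunction. Write $\tau\mathord{\downarrow}$ for $\tau=\tau$. A Horn sequent $\phi\vdash_{\mathbf{x}}\psi$ is a pair of Horn formulas in the same context, and a $\lambda$-ary partial Horn theory $\mathbb{T}$ over $\Sigma$ is a set of Horn sequents. A partial $\Sigma$-structure $M$ consists of sets $(M_s)_{s\in S}$, a partial map $\prod_{i<\alpha}M_{s_i}\rightharpoonup M_s$ for each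 function symbol and a subset of $\prod_{i<\alpha}M_{s_i}$ for each relation symbol. A term denotes a partial map, defined exactly when all its subterms are defined. A formula $\mathbf{x}.\phi$ denotes the subset of $\prod_i M_{s_i}$ of those tuples that satisfy it, where $\tau=\tau'$ and $R(\tau_i)_i$ hold only if all terms occurring in them are defined. $M$ is a partial $\mathbb{T}$-model if for every $(\phi\vdash_{\mathbf{x}}\psi)\in\mathbb{T}$ the interpretation of $\mathbf{x}.\phi$ is contained in that of $\mathbf{x}.\psi$. A $\Sigma$-homomorphism $h\colon M\to N$ is a family of total maps $h_s\colon M_s\to N_s$ such that, whenever $f^M(m_i)_i$ is defined, $f^N(h(m_i))_i$ is defined and equal to $h(f^M(m_i)_i)$, and whenever $(m_i)_i\in R^M$, also $(h(m_i))_i\in R^N$. The partial $\mathbb{T}$-models and $\Sigma$-homomorphisms form a category $\mathbf{PMod}\,\mathbb{T}$. Write $\mathbb{T}\vdash(\phi\vdash_{\mathbf{x}}\psi)$ if the sequent has a well-founded derivation from the sequents in $\mathbb{T}$ by the rules of $\lambda$-ary partial Horn logic: - identity $\phi\vdash_{\mathbf{x}}\phi$, and cut; - substitution: from $\phi\vdash_{\mathbf{x}}\psi$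 infer $\phi(\boldsymbol\tau/\mathbf{x})\wedge\bigwedge_i\tau_i\mathord{\downarrow}\vdash_{\mathbf{y}}\psi(\boldsymbol\tau/\mathbf{x})$, for terms $\mathbf{y}.\tau_i$ of the sorts of the $x_i$; - $\top\vdash_{\mathbf{x}}x_i\mathord{\downarrow}$; - $\phi\wedge\bigwedge_i x_i=y_i\vdash_{\mathbf{z}}\phi(\mathbf{y}/\mathbf{x})$, for a Horn formula $\mathbf{x}.\phi$, a context $\mathbf{y}$ with the same sorts as $\mathbf{x}$, and a context $\mathbf{z}$ containing all $x_i$ and $y_i$; - strictness: $R(\tau_i)_i\vdash_{\mathbf{x}}\tau_j\mathord{\downarrow}$, $\;\tau=\sigma\vdash_{\mathbf{x}}\tau\mathord{\downarrow}$, $\;\tau=\sigma\vdash_{\mathbf{x}}\sigma\mathord{\downarrow}$, $\;f(\tau_i)_i\mathord{\downarrow}\vdash_{\mathbf{x}}\tau_j\mathord{\downarrow}$; - introduction and elimination of conjunctions $\bigwedge_{i<\alpha}$, $\alpha<\lambda$. For a Horn formula $\mathbf{x}.\phi$, the representing model $\langle\mathbf{x}.\phi\rangle_{\mathbb{T}}$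 has as elements of sort $s$ the classes $[\mathbf{x}.\tau]$ of terms $\mathbf{x}.\tau$ of type $s$ with $\mathbb{T}\vdash(\phi\vdash_{\mathbf{x}}\tau\mathord{\downarrow})$, where $[\mathbf{x}.\tau]=[\mathbf{x}.\tau']$ iff $\mathbb{T}\vdash(\phi\vdash_{\mathbf{x}}\tau=\tau')$. A function symbol $f$ is defined at $([\mathbf{x}.\tau_j])_j$ iff $\mathbb{T}\vdash(\phi\vdash_{\mathbf{x}}f(\tau_j)_j\mathord{\downarrow})$, with value $[\mathbf{x}.f(\tau_j)_j]$, and $([\mathbf{x}.\tau_j])_j\in R$ iff $\mathbb{T}\vdash(\phi\vdash_{\mathbf{x}}R(\tau_j)_j)$. This is a partial $\mathbb{T}$-model. **Theorem.** Let $\mathbb{T}$ be a $\lambda$-ary partial Horn theory over an $S$-sorted $\lambda$-ary signature $\Sigma$. For any partial $\mathbb{T}$-model $M$, the following are equivalent: 1. $M$ is a $\lambda$-presentable object of $\mathbf{PMod}\,\mathbb{T}$, i.e. $\mathbf{PMod}\,\mathbb{T}(M,-)$ preserves (small) $\lambda$-filtered colimits. 2. There is a $\lambda$-ary Horn formula $\mathbf{x}.\phi$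 over $\Sigma$ such that $M\cong\langle\mathbf{x}.\phi\rangle_{\mathbb{T}}$ in $\mathbf{PMod}\,\mathbb{T}$. -/

import Mathlib

open CategoryTheory

universe u

namespace PHL

/-! ### Ordinals below a regular cardinal

The ordinals `α < κ` are the elements of the well-ordered type `κ.ord.ToType`, and the
indices `i < α` are the elements of the initial segment `Set.Iio α`. -/

section Ordinals

lemma mk_Iio_lt (κ : Cardinal.{u}) (α : κ.ord.ToType) : Cardinal.mk (Set.Iio α) < κ := by
  simpa using Cardinal.mk_Iio_lt α (by simp)

lemma exists_Iio_equiv (κ : Cardinal.{u}) (I : Type u) (hI : Cardinal.mk I < κ) :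
    ∃ α : κ.ord.ToType, Nonempty (I ≃ Set.Iio α) := by
  have h : (Cardinal.mk I).ord < Ordinal.type (α := κ.ord.ToType) (· < ·) := by
    rw [Ordinal.type_toType]; exact Cardinal.ord_lt_ord.2 hI
  refine ⟨Ordinal.enum (α := κ.ord.ToType) (· < ·) ⟨_, h⟩, ?_⟩
  rw [← Cardinal.eq]
  have := Ordinal.card_typein (r := fun a b : κ.ord.ToType => a < b)
    (x := Ordinal.enum (α := κ.ord.ToType) (· < ·) ⟨_, h⟩)
  rw [Ordinal.typein_enum, Cardinal.card_ord] at this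
  exact this

variable (κ : Cardinal.{u}) [hκ : Fact κ.IsRegular]

lemma nat_lt_ord (n : ℕ) : (n : Ordinal.{u}) < κ.ord :=
  (Ordinal.natCast_lt_omega0 n).trans_le
    (by simpa using Cardinal.ord_le_ord.2 hκ.out.aleph0_le)

/-- The natural number `n`, as an ordinal below `κ`. -/
noncomputable def fin (n : ℕ) : κ.ord.ToType :=
  Ordinal.ToType.mk ⟨(n : Ordinal.{u}), nat_lt_ord κ n⟩

lemma fin_lt_fin {m n : ℕ} : fin κ m < fin κ n ↔ m < n := by
  rw [fin, fin, OrderIso.lt_iff_lt, ← Subtype.coe_lt_coe]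
  exact Nat.cast_lt

lemma lt_fin {n : ℕ} {i : κ.ord.ToType} (hi : i < fin κ n) : ∃ m < n, i = fin κ m := by
  obtain ⟨⟨o, ho⟩, rfl⟩ := Ordinal.ToType.mk.surjective i
  rw [fin, OrderIso.lt_iff_lt, ← Subtype.coe_lt_coe] at hi
  have h : o < (n : Ordinal.{u}) := hi
  obtain ⟨m, rfl⟩ := Ordinal.lt_omega0.1 (h.trans (Ordinal.natCast_lt_omega0 n))
  exact ⟨m, by exact_mod_cast h, rfl⟩

lemma not_lt_zero (i : κ.ord.ToType) : ¬ i < fin κ 0 := fun h => by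
  obtain ⟨m, hm, -⟩ := lt_fin κ h
  omega

/-- The least element of the ordinal `2`. -/
noncomputable def i0 : Set.Iio (fin κ 2) := ⟨fin κ 0, (fin_lt_fin κ).2 (by norm_num)⟩

/-- The other element of the ordinal `2`. -/
noncomputable def i1 : Set.Iio (fin κ 2) := ⟨fin κ 1, (fin_lt_fin κ).2 (by norm_num)⟩

lemma i1_ne_i0 : i1 κ ≠ i0 κ := fun h =>
  absurd ((fin_lt_fin κ (m := 0) (n := 1)).2 (by norm_num))
    (by rw [show fin κ 1 = fin κ 0 from congrArg Subtype.val h]; exact lt_irrefl _)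

lemma eq_i0_or_i1 (i : Set.Iio (fin κ 2)) : i = i0 κ ∨ i = i1 κ := by
  obtain ⟨m, hm, h⟩ := lt_fin κ i.2
  interval_cases m
  · exact Or.inl (Subtype.ext h)
  · exact Or.inr (Subtype.ext h)

variable {κ} in
open Classical in
/-- The family `(a, b)` indexed by the ordinal `2`. -/
noncomputable def pair {α : Type*} (a b : α) (i : Set.Iio (fin κ 2)) : α :=
  if i = i0 κ then a else b

lemma pair_i0 {α : Type*} (a b : α) : pair a b (i0 κ) = a := if_pos rfl

lemma pair_i1 {α : Type*} (a b : α) : pair a b (i1 κ) = b := if_neg (i1_ne_i0 κ)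

end Ordinals

/-! ### Syntax -/

/-- A tuple of sorts `(s_i)_{i < α}` with `α < κ`. It serves as the list of argument sorts of a
symbol, and as the context `(x_i : s_i)_{i < α}` whose variables are the indices `i < α`. -/
structure Ctx (κ : Cardinal.{u}) (S : Type u) : Type u where
  length : κ.ord.ToType
  sort : Set.Iio length → S

/-- The variables of sort `s` in the context `x`. -/
def Ctx.Var {κ : Cardinal.{u}} {S : Type u} (x : Ctx κ S) (s : S) : Type u :=
  {i : Set.Iio x.length // x.sort i = s}

/-- The variable `x_i : s_i` of the context `x`. -/
def Ctx.v {κ : Cardinal.{u}} {S : Type u} (x : Ctx κ S) (i : Set.Iio x.length) :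
    x.Var (x.sort i) := ⟨i, rfl⟩

/-- `S`-sorted `κ`-ary signatures. -/
structure Signature (κ : Cardinal.{u}) (S : Type u) : Type (u + 1) where
  Fn : Type u
  Rel : Type u
  fnArity : Fn → Ctx κ S
  fnSort : Fn → S
  relArity : Rel → Ctx κ S

variable {κ : Cardinal.{u}} {S : Type u} {Sg : Signature κ S}

/-- Terms `x.τ` of type `s` in the context `x`. -/
inductive Term (Sg : Signature κ S) (x : Ctx κ S) : S → Type u
  | var {s : S} (v : x.Var s) : Term Sg x s
  | app (f : Sg.Fn) (τ : ∀ j, Term Sg x ((Sg.fnArity f).sort j)) : Term Sg x (Sg.fnSort f)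

/-- Horn formulas `x.φ` in the context `x`. The truth constant is the empty conjunction. -/
inductive Formula (Sg : Signature κ S) (x : Ctx κ S) : Type u
  | rel (R : Sg.Rel) (τ : ∀ j, Term Sg x ((Sg.relArity R).sort j)) : Formula Sg x
  | eq {s : S} (τ σ : Term Sg x s) : Formula Sg x
  | conj (α : κ.ord.ToType) (φ : Set.Iio α → Formula Sg x) : Formula Sg x

/-- Simultaneous substitution `τ(ρ/x)` of terms `y.ρ_i` for the variables `x_i`. -/
def Term.subst {x y : Ctx κ S} (ρ : ∀ i, Term Sg y (x.sort i)) {s : S} :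
    Term Sg x s → Term Sg y s
  | .var v => v.2 ▸ ρ v.1
  | .app f τ => .app f fun j => (τ j).subst ρ

/-- Simultaneous substitution `φ(ρ/x)`. -/
def Formula.subst {x y : Ctx κ S} (ρ : ∀ i, Term Sg y (x.sort i)) :
    Formula Sg x → Formula Sg y
  | .rel R τ => .rel R fun j => (τ j).subst ρ
  | .eq τ σ => .eq (τ.subst ρ) (σ.subst ρ)
  | .conj α φ => .conj α fun i => (φ i).subst ρ

/-- `τ↓`, i.e. `τ = τ`. -/
def Term.defd {x : Ctx κ S} {s : S} (τ : Term Sg x s) : Formula Sg x := .eq τ τ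

/-- The truth constant `⊤`. -/
noncomputable def Formula.top [Fact κ.IsRegular] {x : Ctx κ S} : Formula Sg x :=
  .conj (fin κ 0) fun i => absurd i.2 (not_lt_zero κ i.1)

/-- The binary conjunction, i.e. the conjunction indexed by the ordinal `2`. -/
noncomputable def Formula.and [Fact κ.IsRegular] {x : Ctx κ S} (φ ψ : Formula Sg x) :
    Formula Sg x :=
  .conj (fin κ 2) (pair φ ψ)

/-- A Horn formula `x.φ`. -/
structure HornFormula (Sg : Signature κ S) : Type u where
  ctx : Ctx κ S
  form : Formula Sg ctx

/-- A Horn sequent `φ ⊢_x ψ`. -/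
structure Sequent (Sg : Signature κ S) : Type u where
  ctx : Ctx κ S
  ante : Formula Sg ctx
  succ : Formula Sg ctx

/-- A `κ`-ary partial Horn theory over `Sg`. -/
abbrev Theory (Sg : Signature κ S) : Type u := Set (Sequent Sg)

/-- `Derives T φ ψ` says that `φ ⊢_x ψ` is a theorem of `T` in `κ`-ary partial Horn logic. -/
inductive Derives [Fact κ.IsRegular] (T : Theory Sg) :
    ∀ {x : Ctx κ S}, Formula Sg x → Formula Sg x → Prop
  | ax (A : Sequent Sg) (h : A ∈ T) : Derives T A.ante A.succ
  | id {x : Ctx κ S} (φ : Formula Sg x) : Derives T φ φ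
  | cut {x : Ctx κ S} {φ ψ χ : Formula Sg x} :
      Derives T φ ψ → Derives T ψ χ → Derives T φ χ
  | subst {x y : Ctx κ S} {φ ψ : Formula Sg x} (ρ : ∀ i, Term Sg y (x.sort i)) :
      Derives T φ ψ →
        Derives T ((φ.subst ρ).and (.conj x.length fun i => (ρ i).defd)) (ψ.subst ρ)
  | refl {x : Ctx κ S} (i : Set.Iio x.length) :
      Derives T .top (Term.var (Sg := Sg) (x.v i)).defd
  | eq {x z : Ctx κ S} (φ : Formula Sg x) (a b : ∀ i, z.Var (x.sort i))
      (ha : Function.Injective fun i => (a i).1) (hb : Function.Injective fun i => (b i).1) :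
      Derives T
        ((φ.subst fun i => .var (a i)).and (.conj x.length fun i => .eq (.var (a i)) (.var (b i))))
        (φ.subst fun i => .var (b i))
  | srel {x : Ctx κ S} (R : Sg.Rel) (τ : ∀ j, Term Sg x ((Sg.relArity R).sort j))
      (j : Set.Iio (Sg.relArity R).length) : Derives T (.rel R τ) (τ j).defd
  | seq_left {x : Ctx κ S} {s : S} (τ σ : Term Sg x s) : Derives T (.eq τ σ) τ.defd
  | seq_right {x : Ctx κ S} {s : S} (τ σ : Term Sg x s) : Derives T (.eq τ σ) σ.defd
  | sfun {x : Ctx κ S} (f : Sg.Fn) (τ : ∀ j, Term Sg x ((Sg.fnArity f).sort j))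
      (j : Set.Iio (Sg.fnArity f).length) : Derives T (Term.app f τ).defd (τ j).defd
  | econj {x : Ctx κ S} (α : κ.ord.ToType) (φ : Set.Iio α → Formula Sg x) (j : Set.Iio α) :
      Derives T (.conj α φ) (φ j)
  | iconj {x : Ctx κ S} (φ : Formula Sg x) (α : κ.ord.ToType) (ψ : Set.Iio α → Formula Sg x) :
      (∀ i, Derives T φ (ψ i)) → Derives T φ (.conj α ψ)

/-! ### Partial structures and partial models -/

/-- Partial `Sg`-structures. -/
structure PStr (Sg : Signature κ S) : Type (u + 1) where
  carrier : S → Type u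
  fn : ∀ f : Sg.Fn, (∀ j, carrier ((Sg.fnArity f).sort j)) →. carrier (Sg.fnSort f)
  rel : ∀ R : Sg.Rel, Set (∀ j, carrier ((Sg.relArity R).sort j))

/-- A tuple of partial values, defined iff all its components are. -/
def tuple {I : Type*} {X : I → Type*} (p : ∀ i, Part (X i)) : Part (∀ i, X i) :=
  ⟨∀ i, (p i).Dom, fun h i => (p i).get (h i)⟩

/-- The interpretation of a term in context, a partial map `∏ M_{s_i} ⇀ M_s`: a compound term is
defined at `m` iff all its arguments are and the function symbol is defined at their values. -/
def Term.interp (M : PStr Sg) {x : Ctx κ S} {s : S} :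
    Term Sg x s → (∀ i, M.carrier (x.sort i)) →. M.carrier s
  | .var v, m => Part.some (v.2 ▸ m v.1)
  | .app f τ, m =>
    (tuple fun j => (τ j).interp M m).bind (M.fn f)

/-- The interpretation of a Horn formula in context, a subset of `∏ M_{s_i}`. -/
def Formula.interp (M : PStr Sg) {x : Ctx κ S} :
    Formula Sg x → Set (∀ i, M.carrier (x.sort i))
  | .rel R τ => {m | ∃ h : ∀ j, ((τ j).interp M m).Dom,
      (fun j => ((τ j).interp M m).get (h j)) ∈ M.rel R}
  | .eq τ σ => {m | ∃ a, a ∈ τ.interp M m ∧ a ∈ σ.interp M m}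
  | .conj _ φ => ⋂ i, (φ i).interp M

/-- `Sg`-homomorphisms. -/
@[ext]
structure Hom (M N : PStr Sg) : Type u where
  toFun : ∀ s, M.carrier s → N.carrier s
  map_fn : ∀ (f : Sg.Fn) (m : ∀ j, M.carrier ((Sg.fnArity f).sort j)),
    ∀ a ∈ M.fn f m, toFun _ a ∈ N.fn f fun j => toFun _ (m j)
  map_rel : ∀ (R : Sg.Rel), ∀ m ∈ M.rel R, (fun j => toFun _ (m j)) ∈ N.rel R

instance : Category.{u} (PStr Sg) where
  Hom := Hom
  id M := ⟨fun _ a => a, fun _ _ _ h => h, fun _ _ h => h⟩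
  comp g h := ⟨fun s a => h.toFun s (g.toFun s a),
    fun f m a ha => h.map_fn f _ _ (g.map_fn f m a ha),
    fun R m hm => h.map_rel R _ (g.map_rel R m hm)⟩

/-- `M` is a partial `T`-model: every sequent of `T` is valid in `M`. -/
def IsModel (T : Theory Sg) : ObjectProperty (PStr Sg) := fun M =>
  ∀ A ∈ T, A.ante.interp M ⊆ A.succ.interp M

/-- The category of partial `T`-models, a full subcategory of that of partial structures. -/
abbrev PMod (T : Theory Sg) : Type (u + 1) := (IsModel T).FullSubcategory

/-! ### Facts about derivations that make the representing model well defined -/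

section Derivations

lemma Term.subst_subst {x y z : Ctx κ S} (ρ : ∀ i, Term Sg y (x.sort i))
    (θ : ∀ i, Term Sg z (y.sort i)) {s : S} (τ : Term Sg x s) :
    (τ.subst ρ).subst θ = τ.subst fun i => (ρ i).subst θ := by
  induction τ with
  | var v => obtain ⟨i, rfl⟩ := v; rfl
  | app f τ ih => simp only [Term.subst, ih]

lemma Formula.subst_subst {x y z : Ctx κ S} (ρ : ∀ i, Term Sg y (x.sort i))
    (θ : ∀ i, Term Sg z (y.sort i)) (φ : Formula Sg x) :
    (φ.subst ρ).subst θ = φ.subst fun i => (ρ i).subst θ := by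
  induction φ with
  | rel R τ => simp only [Formula.subst, Term.subst_subst]
  | eq τ σ => simp only [Formula.subst, Term.subst_subst]
  | conj α φ ih => simp only [Formula.subst, ih]

lemma exists_ctx (I : Type u) (hI : Cardinal.mk I < κ) (s : I → S) :
    ∃ (z : Ctx κ S) (v : ∀ i, z.Var (s i)), Function.Injective (fun i => (v i).1) ∧
      ∀ P : S → Type u, ∀ τ : ∀ i, P (s i), ∃ ρ : ∀ j, P (z.sort j),
        ∀ Q : ∀ t, P t → Prop, (∀ i, Q _ (τ i)) → (∀ j, Q _ (ρ j)) ∧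
        ∀ i, (v i).2 ▸ ρ (v i).1 = τ i := by
  obtain ⟨α, ⟨e⟩⟩ := exists_Iio_equiv κ I hI
  refine ⟨⟨α, fun j => s (e.symm j)⟩, fun i => ⟨e i, by simp⟩, e.injective, fun P τ => ?_⟩
  refine ⟨fun j => τ (e.symm j), fun Q hQ => ⟨fun j => hQ _, fun i => ?_⟩⟩
  have key : ∀ (k : I) (h : k = i) (h' : s k = s i), h' ▸ τ k = τ i := by
    rintro k rfl _; rfl
  exact key _ (by simp) _

variable [Fact κ.IsRegular] {T : Theory Sg} {x y : Ctx κ S}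

lemma Formula.subst_and (ρ : ∀ i, Term Sg y (x.sort i)) (φ ψ : Formula Sg x) :
    (φ.and ψ).subst ρ = (φ.subst ρ).and (ψ.subst ρ) := by
  refine congrArg (Formula.conj (fin κ 2)) (funext fun i => ?_)
  rcases eq_i0_or_i1 κ i with rfl | rfl
  · rw [pair_i0, pair_i0]
  · rw [pair_i1, pair_i1]

lemma Derives.top (φ : Formula Sg x) : Derives T φ .top :=
  .iconj _ _ _ fun i => absurd i.2 (not_lt_zero κ i.1)

lemma Derives.and {φ ψ χ : Formula Sg x} (h : Derives T φ ψ) (h' : Derives T φ χ) :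
    Derives T φ (ψ.and χ) := by
  refine .iconj _ _ _ fun i => ?_
  rcases eq_i0_or_i1 κ i with rfl | rfl
  · rwa [pair_i0]
  · rwa [pair_i1]

lemma Derives.subst_of {φ ψ : Formula Sg x} {θ : Formula Sg y} (h : Derives T φ ψ)
    (ρ : ∀ i, Term Sg y (x.sort i)) (hρ : ∀ i, Derives T θ (ρ i).defd)
    (hφ : Derives T θ (φ.subst ρ)) : Derives T θ (ψ.subst ρ) :=
  .cut (hφ.and (.iconj _ _ _ hρ)) (.subst ρ h)

lemma Derives.eq_congr {w : Ctx κ S} (φ : Formula Sg w) (σ τ : ∀ i, Term Sg x (w.sort i))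
    {θ : Formula Sg x} (h : ∀ i, Derives T θ (.eq (σ i) (τ i)))
    (hφ : Derives T θ (φ.subst σ)) : Derives T θ (φ.subst τ) := by
  have hI : Cardinal.mk (Set.Iio w.length ⊕ Set.Iio w.length) < κ := by
    rw [← Cardinal.add_def]
    exact Cardinal.add_lt_of_lt (Fact.out : κ.IsRegular).aleph0_le (mk_Iio_lt κ _) (mk_Iio_lt κ _)
  obtain ⟨z, v, hv, hz⟩ := exists_ctx (κ := κ) _ hI (Sum.elim w.sort w.sort)
  obtain ⟨ρ, hρ⟩ := hz (Term Sg x) (fun | .inl i => σ i | .inr i => τ i)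
  obtain ⟨hd, hρ⟩ := hρ (fun _ t => Derives T θ t.defd) (by
    rintro (i | i)
    · exact .cut (h i) (.seq_left _ _)
    · exact .cut (h i) (.seq_right _ _))
  have ha : ∀ i, (Term.var (Sg := Sg) (v (.inl i))).subst ρ = σ i := fun i => hρ (.inl i)
  have hb : ∀ i, (Term.var (Sg := Sg) (v (.inr i))).subst ρ = τ i := fun i => hρ (.inr i)
  have ea : (φ.subst fun i => .var (v (.inl i))).subst ρ = φ.subst σ :=
    (Formula.subst_subst _ _ _).trans (congrArg (fun r => φ.subst r) (funext ha))
  have eb : (φ.subst fun i => .var (v (.inr i))).subst ρ = φ.subst τ :=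
    (Formula.subst_subst _ _ _).trans (congrArg (fun r => φ.subst r) (funext hb))
  have := (Derives.eq (T := T) φ (fun i => v (.inl i)) (fun i => v (.inr i))
    (fun i j hij => Sum.inl_injective (hv hij))
    (fun i j hij => Sum.inr_injective (hv hij))).subst_of ρ hd (θ := θ) (by
      rw [Formula.subst_and]
      refine .and (ea ▸ hφ) (.iconj _ _ _ fun i => ?_)
      have e : (Formula.eq (Sg := Sg) (.var (v (.inl i))) (.var (v (.inr i)))).subst ρ =
        .eq (σ i) (τ i) := congrArg₂ Formula.eq (ha i) (hb i)
      exact e ▸ h i)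
  exact eb ▸ this

/-- A context of two variables of sort `s`. -/
noncomputable def Ctx.pair (s : S) : Ctx κ S := ⟨fin κ 2, fun _ => s⟩

/-- The formula `x_0 = x_1` in a context of two variables. -/
noncomputable def pairEq (Sg : Signature κ S) (s : S) : Formula Sg (Ctx.pair s) :=
  .eq (s := s) (.var ⟨i0 κ, rfl⟩) (.var ⟨i1 κ, rfl⟩)

lemma pairEq_subst {s : S} (σ τ : Term Sg x s) :
    (pairEq Sg s).subst (y := x) (pair σ τ) = .eq σ τ :=
  congrArg₂ (Formula.eq (s := s)) (pair_i0 κ σ τ) (pair_i1 κ σ τ)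

lemma Derives.eq_congr_pair {s : S} {σ τ σ' τ' : Term Sg x s} {θ : Formula Sg x}
    (h : Derives T θ (.eq σ σ')) (h' : Derives T θ (.eq τ τ'))
    (H : Derives T θ (.eq σ τ)) : Derives T θ (.eq σ' τ') := by
  rw [← pairEq_subst] at H ⊢
  refine Derives.eq_congr (pairEq Sg s) (pair σ τ) (pair σ' τ') (fun i => ?_) H
  rcases eq_i0_or_i1 κ i with rfl | rfl
  · rw [pair_i0, pair_i0]; exact h
  · rw [pair_i1, pair_i1]; exact h'

lemma Derives.symm {s : S} {σ τ : Term Sg x s} {θ : Formula Sg x}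
    (h : Derives T θ (.eq σ τ)) : Derives T θ (.eq τ σ) :=
  .eq_congr_pair h (.cut h (.seq_left _ _)) (.cut h (.seq_left _ _))

lemma Derives.trans {s : S} {σ τ ρ : Term Sg x s} {θ : Formula Sg x}
    (h : Derives T θ (.eq σ τ)) (h' : Derives T θ (.eq τ ρ)) : Derives T θ (.eq σ ρ) :=
  .eq_congr_pair (.cut h (.seq_left _ _)) h' h

lemma Derives.rel_congr (R : Sg.Rel) (σ τ : ∀ j, Term Sg x ((Sg.relArity R).sort j))
    {θ : Formula Sg x} (h : ∀ j, Derives T θ (.eq (σ j) (τ j)))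
    (hR : Derives T θ (.rel R σ)) : Derives T θ (.rel R τ) :=
  Derives.eq_congr (w := Sg.relArity R) (.rel R fun j => .var ((Sg.relArity R).v j)) σ τ h hR

lemma Derives.fn_congr (f : Sg.Fn) (σ τ : ∀ j, Term Sg x ((Sg.fnArity f).sort j))
    {θ : Formula Sg x} (h : ∀ j, Derives T θ (.eq (σ j) (τ j)))
    (hf : Derives T θ (Term.app f σ).defd) : Derives T θ (.eq (.app f σ) (.app f τ)) := by
  let A := Sg.fnArity f
  have hI : Cardinal.mk (Set.Iio A.length ⊕ Set.Iio A.length) < κ := by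
    rw [← Cardinal.add_def]
    exact Cardinal.add_lt_of_lt (Fact.out : κ.IsRegular).aleph0_le (mk_Iio_lt κ _) (mk_Iio_lt κ _)
  obtain ⟨z, v, -, hz⟩ := exists_ctx (κ := κ) _ hI (Sum.elim A.sort A.sort)
  obtain ⟨ρ, hρ⟩ := hz (fun s => {p : Term Sg x s × Term Sg x s // Derives T θ (.eq p.1 p.2)})
    (fun | .inl j => ⟨(σ j, σ j), .cut (h j) (.seq_left _ _)⟩ | .inr j => ⟨(σ j, τ j), h j⟩)
  have hρ := (hρ (fun _ _ => True) fun _ => trivial).2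
  have hv : ∀ {s : S} (v : z.Var s),
      (Term.var (Sg := Sg) v).subst (fun j => (ρ j).1.1) = ((v.2 ▸ ρ v.1 :
        {p : Term Sg x s × Term Sg x s // Derives T θ (.eq p.1 p.2)})).1.1 ∧
      (Term.var (Sg := Sg) v).subst (fun j => (ρ j).1.2) = ((v.2 ▸ ρ v.1 :
        {p : Term Sg x s × Term Sg x s // Derives T θ (.eq p.1 p.2)})).1.2 := by
    rintro s ⟨i, rfl⟩
    exact ⟨rfl, rfl⟩
  have e1 : (fun j => (Term.var (Sg := Sg) (v (.inl j))).subst fun j => (ρ j).1.1) = σ :=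
    funext fun j => (hv (v (.inl j))).1.trans (congrArg (fun p => p.1.1) (hρ (.inl j)))
  have e2 : (fun j => (Term.var (Sg := Sg) (v (.inr j))).subst fun j => (ρ j).1.1) = σ :=
    funext fun j => (hv (v (.inr j))).1.trans (congrArg (fun p => p.1.1) (hρ (.inr j)))
  have e3 : (fun j => (Term.var (Sg := Sg) (v (.inl j))).subst fun j => (ρ j).1.2) = σ :=
    funext fun j => (hv (v (.inl j))).2.trans (congrArg (fun p => p.1.2) (hρ (.inl j)))
  have e4 : (fun j => (Term.var (Sg := Sg) (v (.inr j))).subst fun j => (ρ j).1.2) = τ :=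
    funext fun j => (hv (v (.inr j))).2.trans (congrArg (fun p => p.1.2) (hρ (.inr j)))
  let χ : Formula Sg z :=
    .eq (.app f fun j => .var (v (.inl j))) (.app f fun j => .var (v (.inr j)))
  have E1 : χ.subst (fun j => (ρ j).1.1) = .eq (.app f σ) (.app f σ) :=
    congrArg₂ (fun a b => Formula.eq (.app f a) (.app f b)) e1 e2
  have E2 : χ.subst (fun j => (ρ j).1.2) = .eq (.app f σ) (.app f τ) :=
    congrArg₂ (fun a b => Formula.eq (.app f a) (.app f b)) e3 e4
  exact E2 ▸ Derives.eq_congr χ (fun j => (ρ j).1.1) (fun j => (ρ j).1.2) (fun j => (ρ j).2)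
    (E1 ▸ hf)

end Derivations

/-! ### Representing models -/

section Representing

variable [Fact κ.IsRegular] (T : Theory Sg) (A : HornFormula Sg)

/-- The `T`-terms of type `s` generated by the Horn formula `A`. -/
def TTerm (s : S) : Type u := {τ : Term Sg A.ctx s // Derives T A.form τ.defd}

/-- The congruence `≈_T` on `T`-terms. -/
def TTerm.setoid (s : S) : Setoid (TTerm T A s) where
  r τ σ := Derives T A.form (.eq τ.1 σ.1)
  iseqv := ⟨fun τ => τ.2, fun h => h.symm, fun h h' => h.trans h'⟩

/-- The class `[x.τ]_T` of a `T`-term. -/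
def TTerm.mk {T : Theory Sg} {A : HornFormula Sg} {s : S} (τ : Term Sg A.ctx s)
    (h : Derives T A.form τ.defd) : Quotient (TTerm.setoid T A s) :=
  Quotient.mk _ ⟨τ, h⟩

variable {T A} in
lemma TTerm.mk_eq_mk {s : S} {τ σ : Term Sg A.ctx s} {h : Derives T A.form τ.defd}
    {h' : Derives T A.form σ.defd} :
    TTerm.mk τ h = TTerm.mk σ h' ↔ Derives T A.form (.eq τ σ) :=
  ⟨fun e => Quotient.exact e, fun e => Quotient.sound e⟩

/-- The partial structure of `T`-terms generated by `A` modulo `≈_T`. The value of a function symbol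
is computed on chosen representatives; by `mem_fn_reprStr` it does not depend on them. -/
noncomputable def reprStr : PStr Sg where
  carrier s := Quotient (TTerm.setoid T A s)
  fn f a := ⟨Derives T A.form (Term.app f fun j => (a j).out.1).defd, fun h => TTerm.mk _ h⟩
  rel R := {a | ∃ (τ : ∀ j, Term Sg A.ctx ((Sg.relArity R).sort j))
    (h : ∀ j, Derives T A.form (τ j).defd),
    (a = fun j => TTerm.mk (τ j) (h j)) ∧ Derives T A.form (.rel R τ)}

variable {T A}

lemma mem_fn_reprStr (f : Sg.Fn) (τ : ∀ j, Term Sg A.ctx ((Sg.fnArity f).sort j))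
    (h : ∀ j, Derives T A.form (τ j).defd) (b : (reprStr T A).carrier (Sg.fnSort f)) :
    b ∈ (reprStr T A).fn f (fun j => TTerm.mk (τ j) (h j)) ↔
      ∃ h' : Derives T A.form (Term.app f τ).defd, b = TTerm.mk (Term.app f τ) h' := by
  have key : ∀ j, Derives T A.form
      (.eq (TTerm.mk (τ j) (h j)).out.1 (τ j)) := fun j =>
    Quotient.exact (Quotient.out_eq (TTerm.mk (τ j) (h j)))
  constructor
  · rintro ⟨hd, rfl⟩
    have e := Derives.fn_congr f _ τ key hd
    exact ⟨.cut e (.seq_right _ _), TTerm.mk_eq_mk.2 e⟩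
  · rintro ⟨h', rfl⟩
    have e := Derives.fn_congr f τ _ (fun j => (key j).symm) h'
    exact ⟨.cut e (.seq_right _ _), TTerm.mk_eq_mk.2 e.symm⟩

lemma mem_rel_reprStr (R : Sg.Rel) (τ : ∀ j, Term Sg A.ctx ((Sg.relArity R).sort j))
    (h : ∀ j, Derives T A.form (τ j).defd) :
    (fun j => TTerm.mk (τ j) (h j)) ∈ (reprStr T A).rel R ↔ Derives T A.form (.rel R τ) := by
  constructor
  · rintro ⟨σ, hσ, e, hR⟩
    exact Derives.rel_congr R σ τ
      (fun j => (TTerm.mk_eq_mk.1 (congrFun e j)).symm) hR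
  · exact fun hR => ⟨τ, h, rfl, hR⟩

lemma mem_interp_reprStr {y : Ctx κ S} (ρ : ∀ i, Term Sg A.ctx (y.sort i))
    (h : ∀ i, Derives T A.form (ρ i).defd) {s : S} (τ : Term Sg y s)
    (b : (reprStr T A).carrier s) :
    b ∈ τ.interp (reprStr T A) (fun i => TTerm.mk (ρ i) (h i)) ↔
      ∃ h' : Derives T A.form (τ.subst ρ).defd, b = TTerm.mk (τ.subst ρ) h' := by
  induction τ with
  | var v =>
    obtain ⟨i, rfl⟩ := v
    exact ⟨fun e => ⟨h i, Part.mem_some_iff.1 e⟩, fun ⟨_, e⟩ => Part.mem_some_iff.2 e⟩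
  | app f τ ih =>
    refine Part.mem_bind_iff.trans ?_
    constructor
    · rintro ⟨a, ⟨hd, rfl⟩, hb⟩
      have ha := fun j => (ih j _).1 (Part.get_mem (hd j))
      choose h' e using ha
      have e' : (fun j => ((τ j).interp (reprStr T A) fun i => TTerm.mk (ρ i) (h i)).get
          (hd j)) = fun j => TTerm.mk ((τ j).subst ρ) (h' j) := funext e
      have hb' : b ∈ (reprStr T A).fn f (fun j => TTerm.mk ((τ j).subst ρ) (h' j)) := e' ▸ hb
      exact (mem_fn_reprStr f _ h' b).1 hb'
    · rintro ⟨h', rfl⟩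
      have hj : ∀ j, Derives T A.form ((τ j).subst ρ).defd := fun j =>
        .cut h' (.sfun f (fun j => (τ j).subst ρ) j)
      have hm := fun j => (ih j _).2 ⟨hj j, rfl⟩
      exact ⟨_, ⟨fun j => (hm j).1, funext fun j => (hm j).2⟩,
        (mem_fn_reprStr f _ hj _).2 ⟨h', rfl⟩⟩

lemma mem_formula_interp_reprStr {y : Ctx κ S} (ρ : ∀ i, Term Sg A.ctx (y.sort i))
    (h : ∀ i, Derives T A.form (ρ i).defd) (φ : Formula Sg y) :
    (fun i => TTerm.mk (ρ i) (h i)) ∈ φ.interp (reprStr T A) ↔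
      Derives T A.form (φ.subst ρ) := by
  induction φ with
  | rel R τ =>
    constructor
    · rintro ⟨hd, hR⟩
      have ha := fun j => (mem_interp_reprStr ρ h (τ j) _).1 (Part.get_mem (hd j))
      choose h' e using ha
      simp only [e] at hR
      exact (mem_rel_reprStr R _ h').1 hR
    · intro hR
      have hj : ∀ j, Derives T A.form ((τ j).subst ρ).defd := fun j =>
        .cut hR (.srel R (fun j => (τ j).subst ρ) j)
      have hm := fun j => (mem_interp_reprStr ρ h (τ j) _).2 ⟨hj j, rfl⟩
      refine ⟨fun j => (hm j).1, ?_⟩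
      have e : (fun j => ((τ j).interp (reprStr T A) fun i => TTerm.mk (ρ i) (h i)).get
          (hm j).1) = fun j => TTerm.mk ((τ j).subst ρ) (hj j) := funext fun j => (hm j).2
      rw [e]
      exact (mem_rel_reprStr R _ hj).2 hR
  | eq τ σ =>
    constructor
    · rintro ⟨a, h1, h2⟩
      obtain ⟨d1, e1⟩ := (mem_interp_reprStr ρ h _ _).1 h1
      obtain ⟨d2, e2⟩ := (mem_interp_reprStr ρ h _ _).1 h2
      exact TTerm.mk_eq_mk.1 (e1.symm.trans e2)
    · intro e
      have d1 : Derives T A.form (τ.subst ρ).defd := .cut e (.seq_left _ _)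
      have d2 : Derives T A.form (σ.subst ρ).defd := .cut e (.seq_right _ _)
      exact ⟨_, (mem_interp_reprStr ρ h _ _).2 ⟨d1, rfl⟩,
        (mem_interp_reprStr ρ h _ _).2 ⟨d2, TTerm.mk_eq_mk.2 e⟩⟩
  | conj α φ ih =>
    refine Set.mem_iInter.trans ?_
    exact ⟨fun H => .iconj _ _ _ fun i => (ih i).1 (H i),
      fun H i => (ih i).2 (.cut H (.econj α (fun i => (φ i).subst ρ) i))⟩

lemma isModel_reprStr : IsModel T (reprStr T A) := by
  intro B hB m hm
  have hrep : ∀ i, ∃ (t : Term Sg A.ctx (B.ctx.sort i)) (h : Derives T A.form t.defd),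
      m i = TTerm.mk t h := fun i => by
    obtain ⟨⟨t, h⟩, e⟩ := Quotient.exists_rep (m i)
    exact ⟨t, h, e.symm⟩
  choose ρ h e using hrep
  obtain rfl : m = fun i => TTerm.mk (ρ i) (h i) := funext e
  exact (mem_formula_interp_reprStr ρ h B.succ).2 ((Derives.ax B hB).subst_of ρ h
    ((mem_formula_interp_reprStr ρ h B.ante).1 hm))

variable (T A) in
/-- The representing model of the Horn formula `A`, as an object of the category of models. -/
noncomputable def reprModel : PMod T := ⟨reprStr T A, isModel_reprStr⟩

end Representing

end PHL

namespace PHL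

variable {κ : Cardinal.{u}} {S : Type u} {Sg : Signature κ S}

/-! ### Interpretations, homomorphisms and soundness -/

section Semantics

variable {M N : PStr Sg} {x y : Ctx κ S}

/-! The link between formulas and models is the universal property of the representing model:
homomorphisms from the representing model of `x.φ` to a model `N` correspond to tuples of `N`
satisfying `φ`, by evaluation at the generic tuple of variables. Soundness (`Derives.sound`) makes
evaluation of terms well defined on classes (`reprHom`), and a homomorphism is determined by the
generic tuple since every element is the value of a term there (`Hom.ext_of_reprGen`).

Representing models are presentable because satisfaction commutes with `κ`-filtered colimits. Such
colimits of structures are computed on elements, and a formula involves fewer than `κ` arguments and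
conjuncts at each step, so by induction its satisfaction in the colimit already occurs at some stage
(`IsConcrete.exists_formula_interp`). The same fact shows that a `κ`-filtered colimit of models is a
model.

Conversely, every model `M` is the `κ`-filtered colimit of the representing models of formulas
satisfied by tuples of `M` (`Stage.isConcrete_cocone`). If `M` is presentable, its identity factors
through one of them, so `M` is a retract, with section `s` and retraction `r`. Choose terms `τ_i`
representing `s (r [x_i])`; adding the equations `x_i = τ_i` to the formula forces the idempotent `s
∘ r` to become the identity, so the enlarged formula represents `M` itself
(`nonempty_iso_reprModel_of_retract`). -/

lemma mem_tuple {I : Type*} {X : I → Type*} {p : ∀ i, Part (X i)} {a : ∀ i, X i} :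
    a ∈ tuple p ↔ ∀ i, a i ∈ p i :=
  ⟨by rintro ⟨h, rfl⟩ i; exact Part.get_mem (h i),
    fun h => ⟨fun i => (h i).1, funext fun i => (h i).2⟩⟩

lemma Term.mem_interp_app {f : Sg.Fn} {τ : ∀ j, Term Sg x ((Sg.fnArity f).sort j)}
    {m : ∀ i, M.carrier (x.sort i)} {b : M.carrier (Sg.fnSort f)} :
    b ∈ (Term.app f τ).interp M m ↔
      ∃ a, (∀ j, a j ∈ (τ j).interp M m) ∧ b ∈ M.fn f a :=
  Part.mem_bind_iff.trans (exists_congr fun _ => and_congr_left' mem_tuple)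

lemma Formula.mem_interp_rel {R : Sg.Rel} {τ : ∀ j, Term Sg x ((Sg.relArity R).sort j)}
    {m : ∀ i, M.carrier (x.sort i)} :
    m ∈ (Formula.rel R τ).interp M ↔ ∃ a ∈ M.rel R, ∀ j, a j ∈ (τ j).interp M m := by
  constructor
  · rintro ⟨h, hR⟩
    exact ⟨_, hR, fun j => Part.get_mem (h j)⟩
  · rintro ⟨a, hR, ha⟩
    refine ⟨fun j => (ha j).1, ?_⟩
    rwa [show (fun j => ((τ j).interp M m).get (ha j).1) = a from funext fun j => (ha j).2]

lemma Formula.mem_interp_conj {α : κ.ord.ToType} {φ : Set.Iio α → Formula Sg x}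
    {m : ∀ i, M.carrier (x.sort i)} :
    m ∈ (Formula.conj α φ).interp M ↔ ∀ i, m ∈ (φ i).interp M :=
  Set.mem_iInter

lemma Formula.mem_interp_and [Fact κ.IsRegular] {φ ψ : Formula Sg x}
    {m : ∀ i, M.carrier (x.sort i)} :
    m ∈ (φ.and ψ).interp M ↔ m ∈ φ.interp M ∧ m ∈ ψ.interp M := by
  refine mem_interp_conj.trans ⟨fun h => ⟨?_, ?_⟩, fun h i => ?_⟩
  · simpa only [pair_i0] using h (i0 κ)
  · simpa only [pair_i1] using h (i1 κ)
  · rcases eq_i0_or_i1 κ i with rfl | rfl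
    · simpa only [pair_i0] using h.1
    · simpa only [pair_i1] using h.2

lemma Formula.mem_interp_top [Fact κ.IsRegular] (m : ∀ i, M.carrier (x.sort i)) :
    m ∈ (Formula.top (Sg := Sg)).interp M :=
  mem_interp_conj.2 fun i => absurd i.2 (not_lt_zero κ i.1)

lemma Term.mem_interp_defd {s : S} {τ : Term Sg x s} {m : ∀ i, M.carrier (x.sort i)} :
    m ∈ τ.defd.interp M ↔ ∃ a, a ∈ τ.interp M m :=
  exists_congr fun _ => and_self_iff

lemma Hom.mem_interp (h : Hom M N) {m : ∀ i, M.carrier (x.sort i)} {s : S} (τ : Term Sg x s)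
    {b : M.carrier s} (hb : b ∈ τ.interp M m) :
    h.toFun s b ∈ τ.interp N fun i => h.toFun _ (m i) := by
  induction τ with
  | var v =>
    obtain ⟨i, rfl⟩ := v
    obtain rfl := Part.mem_some_iff.1 hb
    exact Part.mem_some _
  | app f τ ih =>
    obtain ⟨a, ha, hb⟩ := Term.mem_interp_app.1 hb
    exact Term.mem_interp_app.2 ⟨_, fun j => ih j (ha j), h.map_fn f a b hb⟩

lemma Hom.mem_formula_interp (h : Hom M N) {m : ∀ i, M.carrier (x.sort i)} (φ : Formula Sg x)
    (hm : m ∈ φ.interp M) : (fun i => h.toFun _ (m i)) ∈ φ.interp N := by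
  induction φ with
  | rel R τ =>
    obtain ⟨a, hR, ha⟩ := Formula.mem_interp_rel.1 hm
    exact Formula.mem_interp_rel.2 ⟨_, h.map_rel R a hR, fun j => h.mem_interp _ (ha j)⟩
  | eq τ σ =>
    obtain ⟨a, h1, h2⟩ := hm
    exact ⟨_, h.mem_interp _ h1, h.mem_interp _ h2⟩
  | conj α φ ih =>
    exact Formula.mem_interp_conj.2 fun i => ih i (Formula.mem_interp_conj.1 hm i)

/-- All substituted terms must be defined at `m`, even those whose variable does not occur in `τ`:
otherwise there is no tuple `a` to evaluate at. -/
lemma Term.interp_subst {m : ∀ i, M.carrier (y.sort i)} {a : ∀ i, M.carrier (x.sort i)}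
    (ρ : ∀ i, Term Sg y (x.sort i)) (ha : ∀ i, a i ∈ (ρ i).interp M m) {s : S}
    (τ : Term Sg x s) : (τ.subst ρ).interp M m = τ.interp M a := by
  induction τ with
  | var v =>
    obtain ⟨i, rfl⟩ := v
    exact Part.eq_some_iff.2 (ha i)
  | app f τ ih => simp only [Term.subst, Term.interp, ih]

lemma Formula.mem_interp_subst {m : ∀ i, M.carrier (y.sort i)}
    {a : ∀ i, M.carrier (x.sort i)} (ρ : ∀ i, Term Sg y (x.sort i))
    (ha : ∀ i, a i ∈ (ρ i).interp M m) (φ : Formula Sg x) :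
    m ∈ (φ.subst ρ).interp M ↔ a ∈ φ.interp M := by
  induction φ with
  | rel R τ => simp only [Formula.subst, Formula.mem_interp_rel, Term.interp_subst ρ ha]
  | eq τ σ =>
    simp only [Formula.subst, Formula.interp, Set.mem_ofPred_eq, Term.interp_subst ρ ha]
  | conj α φ ih => simp only [Formula.subst, Formula.mem_interp_conj, ih]

lemma Derives.sound [Fact κ.IsRegular] {T : Theory Sg} (hM : IsModel T M) {φ ψ : Formula Sg x}
    (h : Derives T φ ψ) : φ.interp M ⊆ ψ.interp M := by
  induction h with
  | ax A hA => exact hM A hA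
  | id φ => exact subset_rfl
  | cut _ _ h h' => exact h.trans h'
  | subst ρ _ ih =>
    intro m hm
    obtain ⟨hm, hρ⟩ := Formula.mem_interp_and.1 hm
    -- The definedness conjuncts of the substitution rule supply the tuple of values at which the
    -- premise is applied.
    have hρ' := fun i => Term.mem_interp_defd.1 (Formula.mem_interp_conj.1 hρ i)
    choose a ha using hρ'
    exact (Formula.mem_interp_subst ρ ha _).2 (ih ((Formula.mem_interp_subst ρ ha _).1 hm))
  | refl i => exact fun m _ => Term.mem_interp_defd.2 ⟨_, Part.mem_some _⟩
  | @eq x z φ a b _ _ =>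
    intro m hm
    obtain ⟨hm, he⟩ := Formula.mem_interp_and.1 hm
    have he' := fun i => Formula.mem_interp_conj.1 he i
    -- The two tuples of variables have the same tuple of values `c`, so both substituted formulas
    -- reduce to `c` satisfying `φ`.
    choose c hc hc' using he'
    exact (Formula.mem_interp_subst _ hc' φ).2 ((Formula.mem_interp_subst _ hc φ).1 hm)
  | srel R τ j =>
    intro m hm
    obtain ⟨a, _, ha⟩ := Formula.mem_interp_rel.1 hm
    exact Term.mem_interp_defd.2 ⟨_, ha j⟩
  | seq_left τ σ => exact fun m ⟨a, h, _⟩ => ⟨a, h, h⟩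
  | seq_right τ σ => exact fun m ⟨a, _, h⟩ => ⟨a, h, h⟩
  | sfun f τ j =>
    intro m hm
    obtain ⟨b, hb⟩ := Term.mem_interp_defd.1 hm
    obtain ⟨a, ha, _⟩ := Term.mem_interp_app.1 hb
    exact Term.mem_interp_defd.2 ⟨_, ha j⟩
  | econj α φ j => exact fun m hm => Formula.mem_interp_conj.1 hm j
  | iconj φ α ψ _ ih => exact fun m hm => Formula.mem_interp_conj.2 fun i => ih i hm

lemma Term.subst_var {s : S} (τ : Term Sg x s) : τ.subst (fun i => .var (x.v i)) = τ := by
  induction τ with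
  | var v => obtain ⟨i, rfl⟩ := v; rfl
  | app f τ ih => simp only [Term.subst, ih]

lemma Formula.subst_var (φ : Formula Sg x) : φ.subst (fun i => .var (x.v i)) = φ := by
  induction φ with
  | rel R τ => simp only [Formula.subst, Term.subst_var]
  | eq τ σ => simp only [Formula.subst, Term.subst_var]
  | conj α φ ih => simp only [Formula.subst, ih]

end Semantics

/-! ### The universal property of representing models -/

section Universal

variable [Fact κ.IsRegular] {T : Theory Sg} {A : HornFormula Sg} {N : PStr Sg}

lemma Derives.var_defd {x : Ctx κ S} (φ : Formula Sg x) (i : Set.Iio x.length) :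
    Derives T φ (Term.var (Sg := Sg) (x.v i)).defd :=
  .cut (.top φ) (.refl i)

variable (T A) in
/-- The generic element `([x.x_i])_i` of the representing model. -/
def reprGen (i : Set.Iio A.ctx.length) : (reprStr T A).carrier (A.ctx.sort i) :=
  TTerm.mk (.var (A.ctx.v i)) (.var_defd _ i)

/-- Interpretation in the representing model is derivability after substitution; here the
substitution is the identity. Thus the generic tuple satisfies exactly the consequences of `A`. -/
lemma reprGen_mem_interp_iff (φ : Formula Sg A.ctx) :
    reprGen T A ∈ φ.interp (reprStr T A) ↔ Derives T A.form φ := by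
  conv_rhs => rw [← φ.subst_var]
  exact mem_formula_interp_reprStr _ (Derives.var_defd _) φ

lemma reprGen_mem_interp : reprGen T A ∈ A.form.interp (reprStr T A) :=
  (reprGen_mem_interp_iff _).2 (.id _)

lemma mk_mem_interp_reprGen {s : S} (τ : Term Sg A.ctx s) (h : Derives T A.form τ.defd) :
    (TTerm.mk τ h : (reprStr T A).carrier s) ∈ τ.interp (reprStr T A) (reprGen T A) :=
  (mem_interp_reprStr _ (Derives.var_defd _) τ _).2
    ⟨by rwa [τ.subst_var], TTerm.mk_eq_mk.2 (by rwa [τ.subst_var])⟩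

lemma exists_mk_eq {s : S} (a : (reprStr T A).carrier s) :
    ∃ (τ : Term Sg A.ctx s) (h : Derives T A.form τ.defd), a = TTerm.mk τ h := by
  obtain ⟨⟨τ, h⟩, e⟩ := Quotient.exists_rep a
  exact ⟨τ, h, e.symm⟩

lemma exists_mk_eq_pi {x : Ctx κ S} (a : ∀ j, (reprStr T A).carrier (x.sort j)) :
    ∃ (τ : ∀ j, Term Sg A.ctx (x.sort j)) (h : ∀ j, Derives T A.form (τ j).defd),
      a = fun j => TTerm.mk (τ j) (h j) := by
  have h := fun j => exists_mk_eq (a j)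
  choose τ h e using h
  exact ⟨τ, h, funext e⟩

lemma reprHom_aux (hN : IsModel T N) {n : ∀ i, N.carrier (A.ctx.sort i)}
    (hn : n ∈ A.form.interp N) {s : S} {τ : Term Sg A.ctx s} (h : Derives T A.form τ.defd) :
    (τ.interp N n).Dom :=
  (Term.mem_interp_defd.1 (h.sound hN hn)).choose_spec.1

/-- The map on the representing model of `A` that evaluates terms at `n`. -/
def reprFun (hN : IsModel T N) {n : ∀ i, N.carrier (A.ctx.sort i)}
    (hn : n ∈ A.form.interp N) (s : S) : (reprStr T A).carrier s → N.carrier s :=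
  Quotient.lift (fun τ => (τ.1.interp N n).get (reprHom_aux hN hn τ.2)) fun τ σ h => by
    obtain ⟨a, h1, h2⟩ := Derives.sound hN h hn
    exact (Part.get_eq_of_mem h1 _).trans (Part.get_eq_of_mem h2 _).symm

lemma reprFun_mem (hN : IsModel T N) {n : ∀ i, N.carrier (A.ctx.sort i)}
    (hn : n ∈ A.form.interp N) {s : S} {τ : Term Sg A.ctx s} (h : Derives T A.form τ.defd) :
    reprFun hN hn s (TTerm.mk τ h) ∈ τ.interp N n :=
  Part.get_mem (reprHom_aux hN hn h)

/-- The homomorphism from the representing model of `A` determined by a tuple satisfying `A`. -/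
def reprHom (hN : IsModel T N) {n : ∀ i, N.carrier (A.ctx.sort i)}
    (hn : n ∈ A.form.interp N) : Hom (reprStr T A) N where
  toFun := reprFun hN hn
  map_fn f m b hb := by
    obtain ⟨τ, h, rfl⟩ := exists_mk_eq_pi m
    obtain ⟨h', rfl⟩ := (mem_fn_reprStr f τ h b).1 hb
    obtain ⟨a, ha, hb⟩ := Term.mem_interp_app.1 (reprFun_mem hN hn h')
    rwa [show a = _ from funext fun j => Part.mem_unique (ha j) (reprFun_mem hN hn (h j))] at hb
  map_rel R m hm := by
    obtain ⟨τ, h, rfl⟩ := exists_mk_eq_pi m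
    obtain ⟨a, hR, ha⟩ := Formula.mem_interp_rel.1
      (((mem_rel_reprStr R τ h).1 hm).sound hN hn)
    rwa [show a = _ from funext fun j => Part.mem_unique (ha j) (reprFun_mem hN hn (h j))] at hR

lemma reprHom_gen (hN : IsModel T N) {n : ∀ i, N.carrier (A.ctx.sort i)}
    (hn : n ∈ A.form.interp N) (i : Set.Iio A.ctx.length) :
    (reprHom hN hn).toFun _ (reprGen T A i) = n i :=
  Part.mem_some_iff.1 (reprFun_mem hN hn (.var_defd _ i))

lemma Hom.mk_mem_interp (g : Hom (reprStr T A) N) {s : S} {τ : Term Sg A.ctx s}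
    (h : Derives T A.form τ.defd) :
    g.toFun s (TTerm.mk τ h) ∈ τ.interp N fun i => g.toFun _ (reprGen T A i) :=
  g.mem_interp τ (mk_mem_interp_reprGen τ h)

/-- Each class `[x.τ]` is the value of `τ` at the generic tuple, and homomorphisms preserve values
of terms, so both maps send it to the unique value of `τ` at the common image. -/
lemma Hom.ext_of_reprGen {g g' : Hom (reprStr T A) N}
    (h : ∀ i, g.toFun _ (reprGen T A i) = g'.toFun _ (reprGen T A i)) : g = g' := by
  ext s a
  obtain ⟨τ, hτ, rfl⟩ := exists_mk_eq a
  refine Part.mem_unique (g.mk_mem_interp hτ) ?_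
  rw [funext h]
  exact g'.mk_mem_interp hτ

end Universal

/-! ### Filtered colimits of partial structures -/

section Colimits

open Limits

variable {J : Type u} [SmallCategory J] {F : J ⥤ PStr Sg}

/-- The transition map of a diagram of partial structures. -/
abbrev trans (F : J ⥤ PStr Sg) {j k : J} (u : j ⟶ k) : Hom (F.obj j) (F.obj k) := F.map u

/-- The leg of a cocone of partial structures. -/
abbrev leg (c : Cocone F) (j : J) : Hom (F.obj j) c.pt := c.ι.app j

lemma leg_trans (c : Cocone F) {j k : J} (u : j ⟶ k) {s : S} (a : (F.obj j).carrier s) :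
    (leg c k).toFun s ((trans F u).toFun s a) = (leg c j).toFun s a :=
  congrArg (fun h : Hom (F.obj j) c.pt => h.toFun s a) (c.w u)

lemma trans_comp {j k l : J} (u : j ⟶ k) (v : k ⟶ l) {s : S} (a : (F.obj j).carrier s) :
    (trans F (u ≫ v)).toFun s a = (trans F v).toFun s ((trans F u).toFun s a) :=
  congrArg (fun h : Hom (F.obj j) (F.obj l) => h.toFun s a) (F.map_comp u v)

lemma hasCardinalLT_Iio (α : κ.ord.ToType) : HasCardinalLT (Set.Iio α) κ :=
  (hasCardinalLT_iff_cardinal_mk_lt _ _).2 (mk_Iio_lt κ α)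

/-- Coordinatewise coincidences at separate stages become simultaneous because a context has fewer
than `κ` variables. -/
lemma exists_trans_eq [Fact κ.IsRegular] [IsCardinalFiltered J κ] {x : Ctx κ S} {j k : J}
    {n : ∀ i, (F.obj j).carrier (x.sort i)} {n' : ∀ i, (F.obj k).carrier (x.sort i)}
    (h : ∀ i, ∃ (l : J) (u : j ⟶ l) (v : k ⟶ l),
      (trans F u).toFun _ (n i) = (trans F v).toFun _ (n' i)) :
    ∃ (l : J) (u : j ⟶ l) (v : k ⟶ l),
      ∀ i, (trans F u).toFun _ (n i) = (trans F v).toFun _ (n' i) := by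
  choose l u v e using h
  have hx := hasCardinalLT_Iio x.length
  obtain ⟨m, a, b, hab⟩ := IsCardinalFiltered.wideSpan u hx
  -- The wide span makes only the composites out of `j` agree; those out of `k` still depend on `i`
  -- and have to be coequalized.
  refine ⟨_, b ≫ IsCardinalFiltered.coeqHom (fun i => v i ≫ a i) hx,
    IsCardinalFiltered.toCoeq (fun i => v i ≫ a i) hx, fun i => ?_⟩
  rw [← IsCardinalFiltered.coeq_condition (fun i => v i ≫ a i) hx i, ← hab i]
  simp only [trans_comp, e]

/-- A cocone of partial structures is concrete if the elements, their equalities, the values of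
function symbols and the instances of relation symbols in its vertex all come from a stage. -/
structure IsConcrete (c : Cocone F) : Prop where
  surj : ∀ {s : S} (a : c.pt.carrier s), ∃ j b, (leg c j).toFun s b = a
  inj : ∀ {s : S} {j k : J} {a : (F.obj j).carrier s} {b : (F.obj k).carrier s},
    (leg c j).toFun s a = (leg c k).toFun s b →
      ∃ (l : J) (u : j ⟶ l) (v : k ⟶ l), (trans F u).toFun s a = (trans F v).toFun s b
  fn : ∀ {f : Sg.Fn} {m b}, b ∈ c.pt.fn f m →
    ∃ j n b', b' ∈ (F.obj j).fn f n ∧ (∀ i, (leg c j).toFun _ (n i) = m i) ∧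
      (leg c j).toFun _ b' = b
  rel : ∀ {R : Sg.Rel} {m}, m ∈ c.pt.rel R →
    ∃ j, ∃ n ∈ (F.obj j).rel R, ∀ i, (leg c j).toFun _ (n i) = m i

/-! ### Concrete cocones: colimit property and descent to stages -/

namespace IsConcrete

variable {c : Cocone F} (hc : IsConcrete c)

include hc

lemma leg_eq_leg (t : Cocone F) {s : S} {j k : J} {a : (F.obj j).carrier s}
    {b : (F.obj k).carrier s} (h : (leg c j).toFun s a = (leg c k).toFun s b) :
    (leg t j).toFun s a = (leg t k).toFun s b := by
  obtain ⟨l, u, v, e⟩ := hc.inj h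
  rw [← leg_trans t u, e, leg_trans]

/-- The map on the vertex of a concrete cocone induced by another cocone. -/
noncomputable def descFun (t : Cocone F) (s : S) (a : c.pt.carrier s) : t.pt.carrier s :=
  (leg t (hc.surj a).choose).toFun s (hc.surj a).choose_spec.choose

lemma descFun_leg (t : Cocone F) {s : S} {j : J} (b : (F.obj j).carrier s) :
    hc.descFun t s ((leg c j).toFun s b) = (leg t j).toFun s b :=
  hc.leg_eq_leg t (hc.surj _).choose_spec.choose_spec

/-- The homomorphism on the vertex of a concrete cocone induced by another cocone. -/
noncomputable def desc (t : Cocone F) : Hom c.pt t.pt where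
  toFun := hc.descFun t
  map_fn f m b hb := by
    obtain ⟨j, n, b', h, hn, rfl⟩ := hc.fn hb
    obtain rfl : _ = m := funext hn
    simp only [descFun_leg]
    exact (leg t j).map_fn f n b' h
  map_rel R m hm := by
    obtain ⟨j, n, h, hn⟩ := hc.rel hm
    obtain rfl : _ = m := funext hn
    simp only [descFun_leg]
    exact (leg t j).map_rel R n h

/-- Concrete cocones are colimit cocones. -/
noncomputable def isColimit : IsColimit c where
  desc := hc.desc
  fac t j := Hom.ext (funext fun _ => funext fun b => hc.descFun_leg t b)
  uniq t g hg := Hom.ext (funext fun s => funext fun a => by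
    obtain ⟨j, b, rfl⟩ := hc.surj a
    exact (congrArg (fun h : Hom (F.obj j) t.pt => h.toFun s b) (hg j)).trans
      (hc.descFun_leg t b).symm)

section Stages

variable [Fact κ.IsRegular] [IsCardinalFiltered J κ]

lemma exists_tuple {x : Ctx κ S} (m : ∀ i, c.pt.carrier (x.sort i)) :
    ∃ (j : J) (n : ∀ i, (F.obj j).carrier (x.sort i)), ∀ i, (leg c j).toFun _ (n i) = m i := by
  have h := fun i => hc.surj (m i)
  choose j b hb using h
  have hx := hasCardinalLT_Iio x.length
  exact ⟨IsCardinalFiltered.max j hx,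
    fun i => (trans F (IsCardinalFiltered.toMax j hx i)).toFun _ (b i),
    fun i => (leg_trans c _ _).trans (hb i)⟩

lemma exists_tuple_eq {x : Ctx κ S} {j k : J} {n : ∀ i, (F.obj j).carrier (x.sort i)}
    {n' : ∀ i, (F.obj k).carrier (x.sort i)}
    (h : ∀ i, (leg c j).toFun _ (n i) = (leg c k).toFun _ (n' i)) :
    ∃ (l : J) (u : j ⟶ l) (v : k ⟶ l),
      ∀ i, (trans F u).toFun _ (n i) = (trans F v).toFun _ (n' i) :=
  exists_trans_eq fun i => hc.inj (h i)

lemma exists_eq {s : S} {j : J} {a b : (F.obj j).carrier s}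
    (h : (leg c j).toFun s a = (leg c j).toFun s b) :
    ∃ (k : J) (u : j ⟶ k), (trans F u).toFun s a = (trans F u).toFun s b := by
  have := isFiltered_of_isCardinalFiltered J κ
  obtain ⟨l, u, v, e⟩ := hc.inj h
  -- The elements agree along two possibly different arrows, which a further arrow coequalizes.
  refine ⟨_, u ≫ IsFiltered.coeqHom u v, ?_⟩
  conv_rhs => rw [IsFiltered.coeq_condition]
  rw [trans_comp, trans_comp, e]

lemma exists_fn {f : Sg.Fn} {j : J} {n : ∀ i, (F.obj j).carrier ((Sg.fnArity f).sort i)}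
    {b : c.pt.carrier (Sg.fnSort f)} (hb : b ∈ c.pt.fn f fun i => (leg c j).toFun _ (n i)) :
    ∃ (k : J) (u : j ⟶ k), ∃ b' ∈ (F.obj k).fn f (fun i => (trans F u).toFun _ (n i)),
      (leg c k).toFun _ b' = b := by
  obtain ⟨k, n', b', h, hn, rfl⟩ := hc.fn hb
  obtain ⟨l, u, v, e⟩ := hc.exists_tuple_eq fun i => (hn i).symm
  refine ⟨l, u, (trans F v).toFun _ b', ?_, leg_trans c v b'⟩
  rw [funext e]
  exact (trans F v).map_fn f n' b' h

lemma exists_rel {R : Sg.Rel} {j : J} {n : ∀ i, (F.obj j).carrier ((Sg.relArity R).sort i)}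
    (hn : (fun i => (leg c j).toFun _ (n i)) ∈ c.pt.rel R) :
    ∃ (k : J) (u : j ⟶ k), (fun i => (trans F u).toFun _ (n i)) ∈ (F.obj k).rel R := by
  obtain ⟨k, n', h, hn⟩ := hc.rel hn
  obtain ⟨l, u, v, e⟩ := hc.exists_tuple_eq fun i => (hn i).symm
  refine ⟨l, u, ?_⟩
  rw [funext e]
  exact (trans F v).map_rel R n' h

/-- Induction on the term: the fewer than `κ` arguments take their values at separate stages, a wide
span brings these together under `j`, and the value of the function symbol then appears at one
further stage. -/
lemma exists_interp {x : Ctx κ S} {j : J} (n : ∀ i, (F.obj j).carrier (x.sort i)) {s : S}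
    (τ : Term Sg x s) {b : c.pt.carrier s}
    (hb : b ∈ τ.interp c.pt fun i => (leg c j).toFun _ (n i)) :
    ∃ (k : J) (u : j ⟶ k), ∃ b' ∈ τ.interp (F.obj k) (fun i => (trans F u).toFun _ (n i)),
      (leg c k).toFun _ b' = b := by
  induction τ with
  | var v =>
    obtain ⟨i, rfl⟩ := v
    obtain rfl := Part.mem_some_iff.1 hb
    exact ⟨j, 𝟙 j, _, Part.mem_some _, leg_trans c _ _⟩
  | app f τ ih =>
    obtain ⟨a, ha, hb⟩ := Term.mem_interp_app.1 hb
    have h := fun i => ih i (ha i)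
    choose k u a' ha' e using h
    obtain ⟨l, v, w, hw⟩ := IsCardinalFiltered.wideSpan u (hasCardinalLT_Iio _)
    obtain rfl : (fun i => (leg c l).toFun _ ((trans F (v i)).toFun _ (a' i))) = a :=
      funext fun i => (leg_trans c _ _).trans (e i)
    obtain ⟨l', v', b', hb', rfl⟩ := hc.exists_fn hb
    refine ⟨l', w ≫ v', b', Term.mem_interp_app.2 ⟨_, fun i => ?_, hb'⟩, rfl⟩
    have := (trans F v').mem_interp _ ((trans F (v i)).mem_interp _ (ha' i))
    simpa only [← trans_comp, ← hw i, Category.assoc] using this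

lemma exists_interp_pi {x y : Ctx κ S} {j : J} (n : ∀ i, (F.obj j).carrier (x.sort i))
    (τ : ∀ i, Term Sg x (y.sort i)) {a : ∀ i, c.pt.carrier (y.sort i)}
    (ha : ∀ i, a i ∈ (τ i).interp c.pt fun i => (leg c j).toFun _ (n i)) :
    ∃ (k : J) (u : j ⟶ k) (a' : ∀ i, (F.obj k).carrier (y.sort i)),
      (∀ i, a' i ∈ (τ i).interp (F.obj k) (fun i => (trans F u).toFun _ (n i))) ∧
      ∀ i, (leg c k).toFun _ (a' i) = a i := by
  have h := fun i => hc.exists_interp n (τ i) (ha i)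
  choose k u a' ha' e using h
  obtain ⟨l, v, w, hw⟩ := IsCardinalFiltered.wideSpan u (hasCardinalLT_Iio _)
  refine ⟨l, w, fun i => (trans F (v i)).toFun _ (a' i), fun i => ?_,
    fun i => (leg_trans c _ _).trans (e i)⟩
  have := (trans F (v i)).mem_interp _ (ha' i)
  simpa only [← trans_comp, ← hw i] using this

/-- This is where the bound on conjunctions enters: fewer than `κ` conjuncts hold at separate
stages, and homomorphisms preserve them into a common later one. -/
lemma exists_formula_interp {x : Ctx κ S} {j : J} (n : ∀ i, (F.obj j).carrier (x.sort i))
    (φ : Formula Sg x) (hn : (fun i => (leg c j).toFun _ (n i)) ∈ φ.interp c.pt) :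
    ∃ (k : J) (u : j ⟶ k), (fun i => (trans F u).toFun _ (n i)) ∈ φ.interp (F.obj k) := by
  have := isFiltered_of_isCardinalFiltered J κ
  induction φ with
  | rel R τ =>
    obtain ⟨a, hR, ha⟩ := Formula.mem_interp_rel.1 hn
    obtain ⟨k, u, a', ha', e⟩ := hc.exists_interp_pi n τ ha
    obtain rfl := funext e
    obtain ⟨l, v, h⟩ := hc.exists_rel hR
    refine ⟨l, u ≫ v, Formula.mem_interp_rel.2 ⟨_, h, fun i => ?_⟩⟩
    simpa only [← trans_comp] using (trans F v).mem_interp _ (ha' i)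
  | eq τ σ =>
    obtain ⟨a, h1, h2⟩ := hn
    obtain ⟨k1, u1, a1, h1, e1⟩ := hc.exists_interp n τ h1
    obtain ⟨k2, u2, a2, h2, e2⟩ := hc.exists_interp n σ h2
    obtain ⟨l, v1, v2, hv⟩ := IsFiltered.span u1 u2
    -- The values of `τ` and `σ` coincide in the vertex, but at the stages found so far they may
    -- still differ.
    obtain ⟨l', w, hw⟩ := hc.exists_eq (a := (trans F v1).toFun _ a1)
      (b := (trans F v2).toFun _ a2)
      (by rw [leg_trans, leg_trans, e1, e2])
    have H1 := (trans F w).mem_interp _ ((trans F v1).mem_interp _ h1)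
    have H2 := (trans F w).mem_interp _ ((trans F v2).mem_interp _ h2)
    rw [← hw] at H2
    have hu : u1 ≫ v1 ≫ w = u2 ≫ v2 ≫ w := by rw [reassoc_of% hv]
    refine ⟨l', u1 ≫ v1 ≫ w, (trans F (v1 ≫ w)).toFun _ a1, ?_, ?_⟩
    · simpa only [trans_comp] using H1
    · simpa only [hu, trans_comp] using H2
  | conj α φ ih =>
    have h := fun i => ih i (Formula.mem_interp_conj.1 hn i)
    choose k u hu using h
    obtain ⟨l, v, w, hw⟩ := IsCardinalFiltered.wideSpan u (hasCardinalLT_Iio _)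
    refine ⟨l, w, Formula.mem_interp_conj.2 fun i => ?_⟩
    simpa only [← trans_comp, hw i] using (trans F (v i)).mem_formula_interp _ (hu i)

/-- A tuple satisfying an antecedent does so already at a stage; the sequent holds there, and the
succedent is carried forward by the leg. -/
lemma isModel {T : Theory Sg} (hF : ∀ j, IsModel T (F.obj j)) : IsModel T c.pt := by
  intro A hA m hm
  obtain ⟨j, n, hn⟩ := hc.exists_tuple m
  obtain rfl := funext hn
  obtain ⟨k, u, h⟩ := hc.exists_formula_interp n _ hm
  simpa only [leg_trans] using (leg c k).mem_formula_interp _ (hF k A hA h)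

end Stages

end IsConcrete

/-! ### Construction of filtered colimits -/

section Construction

/-- The functor taking a partial structure to its carrier of sort `s`. -/
def carrierFunctor (Sg : Signature κ S) (s : S) : PStr Sg ⥤ Type u where
  obj M := M.carrier s
  map g := ↾(Hom.toFun g s)

variable [Fact κ.IsRegular] [hJ : IsCardinalFiltered J κ] (F)

include hJ in
lemma carrierRel_equivalence (s : S) :
    Equivalence (Types.FilteredColimit.Rel (F ⋙ carrierFunctor Sg s)) :=
  have := isFiltered_of_isCardinalFiltered J κ
  Types.FilteredColimit.rel_equiv _

/-- Elements of the stages of a diagram, identified if they become equal at a later stage. -/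
abbrev colimCarrier (s : S) : Type u :=
  Quotient (⟨_, carrierRel_equivalence F s⟩ : Setoid (Σ j, (F ⋙ carrierFunctor Sg s).obj j))

variable {F}

/-- The class of an element of a stage. -/
def colimMk {s : S} {j : J} (a : (F.obj j).carrier s) : colimCarrier F s :=
  Quotient.mk _ ⟨j, a⟩

lemma colimMk_eq_iff {s : S} {j k : J} {a : (F.obj j).carrier s} {b : (F.obj k).carrier s} :
    colimMk a = colimMk b ↔
      ∃ (l : J) (u : j ⟶ l) (v : k ⟶ l), (trans F u).toFun s a = (trans F v).toFun s b :=
  ⟨fun h => Quotient.exact h, fun h => Quotient.sound h⟩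

lemma colimMk_trans {s : S} {j k : J} (u : j ⟶ k) (a : (F.obj j).carrier s) :
    colimMk ((trans F u).toFun s a) = colimMk a :=
  colimMk_eq_iff.2 ⟨k, 𝟙 k, u, by rw [← trans_comp, Category.comp_id]⟩

/-- `b` is the class of a value of `f` at a representative of `m`. -/
def ColimFn (f : Sg.Fn) (m : ∀ i, colimCarrier F ((Sg.fnArity f).sort i))
    (b : colimCarrier F (Sg.fnSort f)) : Prop :=
  ∃ j n b', b' ∈ (F.obj j).fn f n ∧ (∀ i, colimMk (n i) = m i) ∧ colimMk b' = b

/-- Two representatives of the argument tuple agree at a later stage, where `f` is single-valued.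
Arities may be infinite, so this needs `κ`-filteredness. -/
lemma ColimFn.unique {f : Sg.Fn} {m : ∀ i, colimCarrier F ((Sg.fnArity f).sort i)}
    {b b' : colimCarrier F (Sg.fnSort f)} (h : ColimFn f m b) (h' : ColimFn f m b') : b = b' := by
  obtain ⟨j, n, b, hb, hn, rfl⟩ := h
  obtain ⟨k, n', b', hb', hn', rfl⟩ := h'
  obtain ⟨l, u, v, e⟩ := exists_trans_eq fun i => colimMk_eq_iff.1 ((hn i).trans (hn' i).symm)
  have H := (trans F u).map_fn f n b hb
  rw [funext e] at H
  exact colimMk_eq_iff.2 ⟨l, u, v, Part.mem_unique H ((trans F v).map_fn f n' b' hb')⟩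

variable (F) in
/-- The colimit of a diagram of partial structures. -/
noncomputable def colimStr : PStr Sg where
  carrier := colimCarrier F
  fn f m := ⟨∃ b, ColimFn f m b, fun h => h.choose⟩
  rel R := {m | ∃ j, ∃ n ∈ (F.obj j).rel R, ∀ i, colimMk (n i) = m i}

lemma mem_fn_colimStr {f : Sg.Fn} {m : ∀ i, colimCarrier F ((Sg.fnArity f).sort i)}
    {b : colimCarrier F (Sg.fnSort f)} : b ∈ (colimStr F).fn f m ↔ ColimFn f m b :=
  ⟨by rintro ⟨h, rfl⟩; exact h.choose_spec,
    fun h => ⟨⟨b, h⟩, (Exists.choose_spec (⟨b, h⟩ : ∃ b, ColimFn f m b)).unique h⟩⟩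

variable (F) in
/-- The colimit cocone of a diagram of partial structures. -/
noncomputable def colimStrCocone : Cocone F where
  pt := colimStr F
  ι :=
    { app j := (⟨fun _ => colimMk,
        fun _ n b hb => mem_fn_colimStr.2 ⟨j, n, b, hb, fun _ => rfl, rfl⟩,
        fun _ n hn => ⟨j, n, hn, fun _ => rfl⟩⟩ : Hom (F.obj j) (colimStr F))
      naturality _ _ u := Hom.ext (funext fun _ => funext fun a => colimMk_trans u a) }

variable (F) in
lemma isConcrete_colimStrCocone : IsConcrete (colimStrCocone F) where
  surj a := by
    obtain ⟨⟨j, b⟩, rfl⟩ := Quotient.exists_rep a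
    exact ⟨j, b, rfl⟩
  inj h := colimMk_eq_iff.1 h
  fn h := mem_fn_colimStr.1 h
  rel h := h

end Construction

/-! ### Representing models are presentable -/

section Presentable

variable [Fact κ.IsRegular] {T : Theory Sg}

/-- The colimit of the underlying structures is again a model, so the cocone lives in the full
subcategory of models. -/
lemma exists_isConcrete [IsCardinalFiltered J κ] (F : J ⥤ PMod T) :
    ∃ c : Cocone F, IsConcrete ((IsModel T).ι.mapCocone c) := by
  have h := isConcrete_colimStrCocone (F ⋙ (IsModel T).ι)
  refine ⟨⟨⟨_, h.isModel fun j => (F.obj j).property⟩,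
    { app j := ObjectProperty.homMk (leg (colimStrCocone (F ⋙ (IsModel T).ι)) j)
      naturality _ _ u := ?_ }⟩, ⟨h.surj, h.inj, h.fn, h.rel⟩⟩
  exact ObjectProperty.hom_ext _ ((colimStrCocone (F ⋙ (IsModel T).ι)).ι.naturality u)

/-- A homomorphism out of the representing model is a tuple satisfying `A`. Both conditions for a
filtered colimit of hom-sets thus reduce to descending such a tuple, or equalities between two of
them, to a stage. -/
lemma isCardinalPresentable_reprModel (A : HornFormula Sg) :
    IsCardinalPresentable (reprModel T A) κ where
  preservesColimitOfShape J _ _ := ⟨fun {F} => by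
    have := isFiltered_of_isCardinalFiltered J κ
    obtain ⟨c, hc⟩ := exists_isConcrete F
    refine preservesColimit_of_preserves_colimit_cocone
      (isColimitOfReflects (IsModel T).ι hc.isColimit)
      (Types.FilteredColimit.isColimitOf' _ _ (fun g => ?_) (fun j g g' h => ?_))
    · let g' : Hom (reprStr T A) c.pt.obj := InducedCategory.Hom.hom g
      obtain ⟨j, n, hn⟩ := hc.exists_tuple fun i => g'.toFun _ (reprGen T A i)
      have hA := g'.mem_formula_interp _ reprGen_mem_interp
      rw [← funext hn] at hA
      obtain ⟨k, u, hk⟩ := hc.exists_formula_interp n _ hA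
      refine ⟨k, ObjectProperty.homMk (reprHom (F.obj k).property hk), ?_⟩
      refine ObjectProperty.hom_ext _ (Hom.ext_of_reprGen fun i => (hn i).symm.trans ?_)
      refine Eq.symm ((congrArg _ (reprHom_gen (F.obj k).property hk i)).trans ?_)
      exact leg_trans ((IsModel T).ι.mapCocone c) u (n i)
    · let g₁ : Hom (reprStr T A) (F.obj j).obj := InducedCategory.Hom.hom g
      let g₂ : Hom (reprStr T A) (F.obj j).obj := InducedCategory.Hom.hom g'
      have h' : ∀ i, (leg ((IsModel T).ι.mapCocone c) j).toFun _ (g₁.toFun _ (reprGen T A i)) =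
          (leg ((IsModel T).ι.mapCocone c) j).toFun _ (g₂.toFun _ (reprGen T A i)) := fun i =>
        congrArg (fun q : reprModel T A ⟶ c.pt => Hom.toFun q.hom _ (reprGen T A i)) h
      have e := fun i => hc.exists_eq (h' i)
      choose k u e using e
      obtain ⟨l, v, w, hw⟩ := IsCardinalFiltered.wideSpan u (hasCardinalLT_Iio _)
      refine ⟨l, w, ObjectProperty.hom_ext _ (Hom.ext_of_reprGen fun i => ?_)⟩
      change (trans (F ⋙ (IsModel T).ι) w).toFun _ (g₁.toFun _ (reprGen T A i)) =
        (trans (F ⋙ (IsModel T).ι) w).toFun _ (g₂.toFun _ (reprGen T A i))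
      rw [← hw i, trans_comp, trans_comp, e]⟩

end Presentable

end Colimits

/-! ### Retracts of representing models -/

section Retract

variable [Fact κ.IsRegular] {T : Theory Sg}

/-- The idempotent `s ≫ r` reversed, that is `r ≫ s`, is split by imposing the equations `x_i = τ_i`
with `[τ_i] = s (r [x_i])`. -/
lemma nonempty_iso_reprModel_of_retract {M : PMod T} {A : HornFormula Sg}
    (s : M ⟶ reprModel T A) (r : reprModel T A ⟶ M) (hsr : s ≫ r = 𝟙 M) :
    ∃ B : HornFormula Sg, Nonempty (M ≅ reprModel T B) := by
  let s' : Hom M.obj (reprStr T A) := InducedCategory.Hom.hom s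
  let r' : Hom (reprStr T A) M.obj := InducedCategory.Hom.hom r
  have hr : ∀ {t} (a : M.obj.carrier t), r'.toFun t (s'.toFun t a) = a := fun {t} a =>
    congrArg (fun g : M ⟶ M => Hom.toFun g.hom t a) hsr
  obtain ⟨τ, hτ, e⟩ :=
    exists_mk_eq_pi fun i => s'.toFun _ (r'.toFun _ (reprGen T A i))
  have e := congrFun e
  let B : HornFormula Sg :=
    ⟨A.ctx, A.form.and (.conj A.ctx.length fun i => .eq (.var (A.ctx.v i)) (τ i))⟩
  -- The new equations hold at the image of the generic tuple because `r ∘ s ∘ r = r`.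
  have hB : (fun i => r'.toFun _ (reprGen T A i)) ∈ B.form.interp M.obj := by
    refine Formula.mem_interp_and.2 ⟨r'.mem_formula_interp _ reprGen_mem_interp,
      Formula.mem_interp_conj.2 fun i => ⟨_, Part.mem_some _, ?_⟩⟩
    have h := r'.mk_mem_interp (hτ i)
    rwa [← e i, hr] at h
  obtain ⟨hA, he⟩ := Formula.mem_interp_and.1 (reprGen_mem_interp (T := T) (A := B))
  let q : Hom (reprStr T A) (reprStr T B) := reprHom isModel_reprStr hA
  have hq : ∀ i, q.toFun _ (reprGen T A i) = reprGen T B i := reprHom_gen isModel_reprStr hA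
  let p : Hom (reprStr T B) M.obj := reprHom M.property hB
  have hp : ∀ i, p.toFun _ (reprGen T B i) = r'.toFun _ (reprGen T A i) :=
    reprHom_gen M.property hB
  -- `r` factors as the quotient map `q` followed by `p`, so `p ∘ q ∘ s = r ∘ s` is the identity. In
  -- the other direction, `q ∘ s ∘ p` sends `[x_i]` to `[τ_i]`, which is `[x_i]` by the added
  -- equation.
  have hpq : ∀ {t} (a : (reprStr T A).carrier t), p.toFun t (q.toFun t a) = r'.toFun t a := by
    have : (show reprStr T A ⟶ reprStr T B from q) ≫ (show reprStr T B ⟶ M.obj from p) = r' :=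
      Hom.ext_of_reprGen fun i => (congrArg (p.toFun _) (hq i)).trans (hp i)
    exact fun {t} a => congrArg (fun g : Hom (reprStr T A) M.obj => g.toFun t a) this
  refine ⟨B, ⟨ObjectProperty.isoMk _ ⟨(show M.obj ⟶ reprStr T A from s') ≫ q, p, ?_, ?_⟩⟩⟩
  · exact Hom.ext (funext fun t => funext fun a => (hpq _).trans (hr a))
  · refine Hom.ext_of_reprGen fun i => ?_
    change q.toFun _ (s'.toFun _ (p.toFun _ (reprGen T B i))) = reprGen T B i
    rw [hp, e]
    have h := q.mk_mem_interp (hτ i)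
    rw [funext hq] at h
    obtain ⟨a, ha, ha'⟩ := Formula.mem_interp_conj.1 he i
    obtain rfl := Part.mem_some_iff.1 ha
    exact Part.mem_unique h ha'

end Retract

/-! ### The canonical diagram of a model -/

section Stages

variable [hκ : Fact κ.IsRegular] {T : Theory Sg} {M : PMod T}

lemma Derives.var_defd' {x : Ctx κ S} (φ : Formula Sg x) {s : S} (v : x.Var s) :
    Derives T φ (Term.var (Sg := Sg) v).defd := by
  obtain ⟨i, rfl⟩ := v
  exact .var_defd φ i

lemma exists_conj {x : Ctx κ S} {I : Type u} (hI : Cardinal.mk I < κ) (φ : I → Formula Sg x) :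
    ∃ ψ : Formula Sg x, (∀ i, Derives T ψ (φ i)) ∧
      ∀ (N : PStr Sg) (m : ∀ i, N.carrier (x.sort i)), (∀ i, m ∈ (φ i).interp N) →
        m ∈ ψ.interp N := by
  obtain ⟨α, ⟨e⟩⟩ := exists_Iio_equiv κ I hI
  refine ⟨.conj α fun j => φ (e.symm j), fun i => ?_,
    fun N m h => Formula.mem_interp_conj.2 fun j => h _⟩
  simpa using Derives.econj (T := T) α (fun j => φ (e.symm j)) (e i)

omit hκ in
-- Indexing the variables by a set of elements, rather than by a family, is what makes the tuple
-- injective.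
lemma exists_ctx_of_set {N : PStr Sg} (U : Set (Σ s, N.carrier s)) (hU : Cardinal.mk U < κ) :
    ∃ (x : Ctx κ S) (n : ∀ i, N.carrier (x.sort i)),
      Function.Injective (fun i => (⟨_, n i⟩ : Σ s, N.carrier s)) ∧
      ∀ p ∈ U, ∃ v : x.Var p.1, p.2 ∈ (Term.var (Sg := Sg) v).interp N n := by
  obtain ⟨α, ⟨e⟩⟩ := exists_Iio_equiv κ U hU
  refine ⟨⟨α, fun j => (e.symm j).1.1⟩, fun j => (e.symm j).1.2,
    Subtype.val_injective.comp e.symm.injective, fun p hp => ⟨⟨e ⟨p, hp⟩, by simp⟩, ?_⟩⟩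
  refine Part.mem_some_iff.2 ?_
  have key : ∀ (p' : U) (h : p'.1 = p) (h' : p'.1.1 = p.1), p.2 = h' ▸ p'.1.2 := by
    rintro p' rfl _; rfl
  exact key _ (by simp) _

variable (M) in
/-- A Horn formula with an injective tuple of elements of `M` satisfying it. -/
structure Stage : Type u where
  form : HornFormula Sg
  elt : ∀ i, M.obj.carrier (form.ctx.sort i)
  inj : Function.Injective fun i => (⟨_, elt i⟩ : Σ s, M.obj.carrier s)
  sat : elt ∈ form.form.interp M.obj

/-! ### The preorder of stages and its colimit -/

namespace Stage

/-- The homomorphism to `M` determined by a stage. -/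
def hom (A : Stage M) : Hom (reprStr T A.form) M.obj := reprHom M.property A.sat

lemma hom_gen (A : Stage M) (i : Set.Iio A.form.ctx.length) :
    A.hom.toFun _ (reprGen T A.form i) = A.elt i :=
  reprHom_gen M.property A.sat i

lemma hom_mk_mem (A : Stage M) {s : S} {τ : Term Sg A.form.ctx s}
    (h : Derives T A.form.form τ.defd) :
    A.hom.toFun s (TTerm.mk τ h) ∈ τ.interp M.obj A.elt :=
  reprFun_mem M.property A.sat h

omit hκ in
lemma var_unique (A : Stage M) {s : S} {v w : A.form.ctx.Var s} {a : M.obj.carrier s}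
    (hv : a ∈ (Term.var (Sg := Sg) v).interp M.obj A.elt)
    (hw : a ∈ (Term.var (Sg := Sg) w).interp M.obj A.elt) : v = w := by
  obtain ⟨i, rfl⟩ := v
  obtain ⟨j, h⟩ := w
  obtain rfl := Part.mem_some_iff.1 hv
  have hw : A.elt i = h ▸ A.elt j := Part.mem_some_iff.1 hw
  have key : ∀ (s : S) (h : A.form.ctx.sort j = s),
      (⟨_, A.elt j⟩ : Σ s, M.obj.carrier s) = ⟨s, h ▸ A.elt j⟩ := by rintro _ rfl; rfl
  have := A.inj ((key _ h).trans (congrArg (Sigma.mk _) hw.symm))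
  exact Subtype.ext this.symm

/-- The homomorphisms over `M` between the representing models of two stages that send variables
to variables. -/
structure IsTrans (A B : Stage M) (g : Hom (reprStr T A.form) (reprStr T B.form)) : Prop where
  var : ∀ i, ∃ v : B.form.ctx.Var (A.form.ctx.sort i),
    g.toFun _ (reprGen T A.form i) = TTerm.mk (.var v) (.var_defd' _ v)
  comp : ∀ {s} (a : (reprStr T A.form).carrier s), B.hom.toFun s (g.toFun s a) = A.hom.toFun s a

/-- Both maps send `x_i` to a variable of `B` naming the element `A.elt i` of `M`; injectivity of
the tuple of `B` leaves only one. Hence a preorder suffices to index the diagram. -/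
lemma IsTrans.unique {A B : Stage M} {g g' : Hom (reprStr T A.form) (reprStr T B.form)}
    (h : IsTrans A B g) (h' : IsTrans A B g') : g = g' := by
  refine Hom.ext_of_reprGen fun i => ?_
  obtain ⟨v, hv⟩ := h.var i
  obtain ⟨w, hw⟩ := h'.var i
  have h1 := B.hom_mk_mem (Derives.var_defd' (T := T) _ v)
  have h2 := B.hom_mk_mem (Derives.var_defd' (T := T) _ w)
  rw [← hv, h.comp] at h1
  rw [← hw, h'.comp] at h2
  obtain rfl := B.var_unique h1 h2
  rw [hv, hw]

lemma isTrans_id (A : Stage M) : IsTrans A A (𝟙 (reprStr T A.form)) :=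
  ⟨fun i => ⟨A.form.ctx.v i, rfl⟩, fun _ => rfl⟩

lemma IsTrans.trans {A B C : Stage M} {g : reprStr T A.form ⟶ reprStr T B.form}
    {g' : reprStr T B.form ⟶ reprStr T C.form} (h : IsTrans A B g) (h' : IsTrans B C g') :
    IsTrans A C (g ≫ g') := by
  refine ⟨fun i => ?_, fun a => (h'.comp _).trans (h.comp a)⟩
  obtain ⟨⟨j, hj⟩, hv⟩ := h.var i
  -- The sort of a variable is only propositionally that of its index, so it is generalized before
  -- `h'.var` applies.
  have key : ∀ (s : S) (v : B.form.ctx.Var s), ∃ w : C.form.ctx.Var s,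
      Hom.toFun g' s (TTerm.mk (.var v) (.var_defd' _ v)) =
        TTerm.mk (.var w) (.var_defd' _ w) := by
    rintro _ ⟨j, rfl⟩
    exact h'.var j
  obtain ⟨w, hw⟩ := key _ _
  exact ⟨w, (congrArg (Hom.toFun g' _) hv).trans hw⟩

instance : Preorder (Stage M) where
  le A B := ∃ g, IsTrans A B g
  le_refl A := ⟨_, A.isTrans_id⟩
  le_trans _ _ _ := fun ⟨_, h⟩ ⟨_, h'⟩ => ⟨_, h.trans h'⟩

/-- The transition homomorphism between stages. -/
noncomputable def trans {A B : Stage M} (h : A ≤ B) : Hom (reprStr T A.form) (reprStr T B.form) :=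
  h.choose

lemma isTrans_trans {A B : Stage M} (h : A ≤ B) : IsTrans A B (trans h) := h.choose_spec

lemma le_of_var {A B : Stage M} (ρ : ∀ i, B.form.ctx.Var (A.form.ctx.sort i))
    (hρ : ∀ i, A.elt i ∈ (Term.var (Sg := Sg) (ρ i)).interp M.obj B.elt)
    (h : Derives T B.form.form (A.form.form.subst fun i => .var (ρ i))) : A ≤ B := by
  let g : Hom (reprStr T A.form) (reprStr T B.form) := reprHom isModel_reprStr
    ((mem_formula_interp_reprStr _ (fun i => Derives.var_defd' _ (ρ i)) _).2 h)
  have hg : ∀ i, g.toFun _ (reprGen T A.form i) = TTerm.mk (.var (ρ i)) (.var_defd' _ (ρ i)) :=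
    fun i => reprHom_gen isModel_reprStr _ i
  have hc : (show reprStr T A.form ⟶ reprStr T B.form from g) ≫ B.hom = A.hom :=
    Hom.ext_of_reprGen fun i => by
      refine (congrArg (B.hom.toFun _) (hg i)).trans ?_
      rw [hom_gen]
      exact Part.mem_unique (B.hom_mk_mem _) (hρ i)
  exact ⟨g, fun i => ⟨_, hg i⟩,
    fun {s} a => congrArg (fun f : Hom (reprStr T A.form) M.obj => f.toFun s a) hc⟩

/-- The bound has one variable for each element of `M` named by some `A k`, and the conjunction of
all the renamed formulas. Regularity of `κ` keeps this context below `κ`. -/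
lemma exists_upper_bound {K : Type u} (hK : Cardinal.mk K < κ) (A : K → Stage M) :
    ∃ B, ∀ k, A k ≤ B := by
  let E : (Σ k, Set.Iio (A k).form.ctx.length) → Σ s, M.obj.carrier s :=
    fun p => ⟨_, (A p.1).elt p.2⟩
  have hU : Cardinal.mk (Set.range E) < κ := by
    refine Cardinal.mk_range_le.trans_lt ?_
    rw [Cardinal.mk_sigma]
    exact Cardinal.sum_lt_of_isRegular hκ.out hK fun k => mk_Iio_lt κ _
  obtain ⟨x, n, hn, hx⟩ := exists_ctx_of_set (Set.range E) hU
  have hx := fun k i => hx _ ⟨⟨k, i⟩, rfl⟩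
  choose ρ hρ using hx
  obtain ⟨ψ, hψ, hψ'⟩ := exists_conj (T := T) hK
    fun k => (A k).form.form.subst (y := x) fun i => .var (ρ k i)
  exact ⟨⟨⟨x, ψ⟩, n, hn, hψ' _ _ fun k =>
    (Formula.mem_interp_subst _ (hρ k) _).2 (A k).sat⟩, fun k => le_of_var (ρ k) (hρ k) (hψ k)⟩

instance : IsCardinalFiltered (Stage M) κ :=
  isCardinalFiltered_preorder _ _ fun _ A hK => exists_upper_bound hK A

/-- The tuple `m` may have repetitions, so the context is built on its range and `φ` is renamed
along the resulting map of variables. This yields the elements, operations and relations of `M` from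
stages. -/
lemma exists_of_interp {y : Ctx κ S} {m : ∀ i, M.obj.carrier (y.sort i)} (φ : Formula Sg y)
    (hm : m ∈ φ.interp M.obj) :
    ∃ (A : Stage M) (ρ : ∀ i, Term Sg A.form.ctx (y.sort i))
      (h : ∀ i, Derives T A.form.form (ρ i).defd),
      (∀ i, A.hom.toFun _ (TTerm.mk (ρ i) (h i)) = m i) ∧
      Derives T A.form.form (φ.subst ρ) := by
  have hU : Cardinal.mk (Set.range fun i => (⟨_, m i⟩ : Σ s, M.obj.carrier s)) < κ :=
    Cardinal.mk_range_le.trans_lt (mk_Iio_lt κ _)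
  obtain ⟨x, n, hn, hx⟩ := exists_ctx_of_set _ hU
  have hx := fun i => hx _ ⟨i, rfl⟩
  choose v hv using hx
  let A : Stage M := ⟨⟨x, φ.subst fun i => .var (v i)⟩, n, hn,
    (Formula.mem_interp_subst _ hv _).2 hm⟩
  exact ⟨A, fun i => .var (v i), fun i => .var_defd' _ (v i),
    fun i => Part.mem_unique (A.hom_mk_mem _) (hv i), .id _⟩

/-- Keep the variables and their values, and add the equation `τ = σ`, which holds in `M` at those
values. -/
lemma exists_trans_mk_eq (A : Stage M) {s : S} {τ σ : Term Sg A.form.ctx s}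
    (hτ : Derives T A.form.form τ.defd) (hσ : Derives T A.form.form σ.defd)
    (e : A.hom.toFun s (TTerm.mk τ hτ) = A.hom.toFun s (TTerm.mk σ hσ)) :
    ∃ (B : Stage M) (h : A ≤ B),
      (trans h).toFun s (TTerm.mk τ hτ) = (trans h).toFun s (TTerm.mk σ hσ) := by
  let B : Stage M := ⟨⟨A.form.ctx, A.form.form.and (.eq τ σ)⟩, A.elt, A.inj,
    Formula.mem_interp_and.2 ⟨A.sat, _, A.hom_mk_mem hτ, e ▸ A.hom_mk_mem hσ⟩⟩
  obtain ⟨hA, a, h1, h2⟩ := Formula.mem_interp_and.1 (reprGen_mem_interp (T := T) (A := B.form))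
  have h : A ≤ B := le_of_var (fun i => A.form.ctx.v i) (fun i => Part.mem_some _) (by
    rw [Formula.subst_var]
    exact (reprGen_mem_interp_iff (A := B.form) _).1 hA)
  -- The transition map is obtained by choice; being over `M`, it can only send each variable to
  -- itself.
  have hg : (fun i => (trans h).toFun _ (reprGen T A.form i)) = reprGen T B.form := by
    funext i
    obtain ⟨w, hw⟩ := (isTrans_trans h).var i
    have h1 := B.hom_mk_mem (Derives.var_defd' (T := T) _ w)
    rw [← hw, (isTrans_trans h).comp, hom_gen] at h1
    obtain rfl := B.var_unique h1 (w := A.form.ctx.v i) (Part.mem_some _)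
    exact hw
  have h3 := (trans h).mk_mem_interp hτ
  have h4 := (trans h).mk_mem_interp hσ
  rw [hg] at h3 h4
  exact ⟨B, h, (Part.mem_unique h3 h1).trans (Part.mem_unique h2 h4)⟩

variable (M) in
/-- The diagram of the representing models of all stages of `M`. -/
noncomputable def diagram : Stage M ⥤ PMod T where
  obj A := reprModel T A.form
  map u := ObjectProperty.homMk (trans u.le)
  map_id A := ObjectProperty.hom_ext _ ((isTrans_trans _).unique A.isTrans_id)
  map_comp u v := ObjectProperty.hom_ext _
    ((isTrans_trans _).unique ((isTrans_trans u.le).trans (isTrans_trans v.le)))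

variable (M) in
/-- The canonical cocone with vertex `M`. -/
noncomputable def cocone : Limits.Cocone (diagram M) where
  pt := M
  ι :=
    { app A := ObjectProperty.homMk A.hom
      naturality _ _ u := ObjectProperty.hom_ext _
        (Hom.ext (funext fun _ => funext fun a => (isTrans_trans u.le).comp a)) }

lemma isConcrete_cocone : IsConcrete ((IsModel T).ι.mapCocone (cocone M)) where
  surj {s} a := by
    -- Any context with a variable of sort `s` would do; both variables of this one are given the
    -- value `a`.
    obtain ⟨A, ρ, h, e, -⟩ := exists_of_interp (M := M) (y := Ctx.pair s) (m := fun _ => a) .top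
      (Formula.mem_interp_top _)
    exact ⟨A, _, e (i0 κ)⟩
  inj {s A B a b} h := by
    have := isFiltered_of_isCardinalFiltered (Stage M) κ
    let C := IsFiltered.max A B
    let u : A ⟶ C := IsFiltered.leftToMax A B
    let v : B ⟶ C := IsFiltered.rightToMax A B
    obtain ⟨τ, hτ, eτ⟩ := exists_mk_eq ((trans u.le).toFun s a)
    obtain ⟨σ, hσ, eσ⟩ := exists_mk_eq ((trans v.le).toFun s b)
    have e : A.hom.toFun s a = B.hom.toFun s b := h
    obtain ⟨D, w, hw⟩ := C.exists_trans_mk_eq hτ hσ (by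
      rw [← eτ, ← eσ]
      exact ((isTrans_trans u.le).comp a).trans (e.trans ((isTrans_trans v.le).comp b).symm))
    refine ⟨D, u ≫ homOfLE w, v ≫ homOfLE w, ?_⟩
    rw [trans_comp, trans_comp]
    rw [← eτ, ← eσ] at hw
    exact hw
  fn {f m b} hb := by
    obtain ⟨A, ρ, h, e, hd⟩ := exists_of_interp (M := M) (y := Sg.fnArity f) (m := m)
      (Term.app f fun j => .var ((Sg.fnArity f).v j)).defd
      (Term.mem_interp_defd.2 ⟨b, Term.mem_interp_app.2 ⟨m, fun j => Part.mem_some _, hb⟩⟩)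
    have hn := (mem_fn_reprStr f ρ h _).2 ⟨hd, rfl⟩
    refine ⟨A, _, _, hn, e, ?_⟩
    have := A.hom.map_fn f _ _ hn
    rw [funext e] at this
    exact Part.mem_unique this hb
  rel {R m} hm := by
    obtain ⟨A, ρ, h, e, hd⟩ := exists_of_interp (M := M) (y := Sg.relArity R) (m := m)
      (.rel R fun j => .var ((Sg.relArity R).v j))
      (Formula.mem_interp_rel.2 ⟨m, hm, fun j => Part.mem_some _⟩)
    exact ⟨A, _, (mem_rel_reprStr R ρ h).2 hd, e⟩

end Stage

lemma exists_iso_reprModel [IsCardinalPresentable M κ] :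
    ∃ A : HornFormula Sg, Nonempty (M ≅ reprModel T A) := by
  have := essentiallySmallSelf (Stage M)
  -- Presentability factors the identity of `M` through a stage, exhibiting `M` as a retract of a
  -- representing model.
  obtain ⟨A, s, hs⟩ := IsCardinalPresentable.exists_hom_of_isColimit κ
    (Limits.isColimitOfReflects (IsModel T).ι (Stage.isConcrete_cocone (M := M)).isColimit) (𝟙 M)
  exact nonempty_iso_reprModel_of_retract (A := A.form) s (ObjectProperty.homMk A.hom) hs

end Stages

end PHL

theorem mainTheorem9 {κ : Cardinal.{u}} [Fact κ.IsRegular] {S : Type u}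
    (Sg : PHL.Signature κ S) (T : PHL.Theory Sg) (M : PHL.PMod T) :
    IsCardinalPresentable M κ ↔
      ∃ A : PHL.HornFormula Sg, Nonempty (M ≅ PHL.reprModel T A) := by
  refine ⟨fun _ => PHL.exists_iso_reprModel, fun ⟨A, ⟨e⟩⟩ => ?_⟩
  have := PHL.isCardinalPresentable_reprModel (T := T) A
  exact isCardinalPresentable_of_iso e.symm κ
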